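/- Let $G$ be a finitely generated group belonging to the class $\mathcal S$ described below, and suppose that $b_1(H)=b_1(G)$ for every subgroup $H\le G$ of finite index, where $b_1$ denotes the $\mathbb Z$-rank of the abelianization. Then every group $\hat G$ commensurable to $G$ (that is, such that some finite-index subgroup of $\hat G$ is isomorphic to some finite-index subgroup of $G$) has property $R_\infty$: for every automorphism $\varphi$ of $\hat G$ the action $\sigma\cdot\alpha=\sigma\alpha\varphi(\sigma)^{-1}$ of $\hat G$ on itself has infinitely many orbits. Here $S(G)$ is the character sphere of $G$: the quotient of $\mathrm{Hom}(G,\mathbb R)\setminus\{0\}$ by multiplication by positive reals, with the quotient topology. The set $\Sigma^1(G)\subseteq S(G)$ consists of the classes $[\chi]$ for which the full subgraph of the Cayley graph of $G$ (with respect to a finite generating set, the choice of which does not matter) on the vertices $g$ with $\chi(g)\ge 0$ is connected, and $\Sigma^1(G)^c=S(G)\setminus\Sigma^1(G)$. A finitely generated group $G$ belongs to $\mathcal S$ if 1. $\Sigma^1(G)^c$ is nonempty and is contained in an open hemisphere $\{[\chi]\in S(G) : \chi(g)>0\}$ for some $g\in G\setminus[G,G]$; and 2. each connected component $P$ of $\Sigma^1(G)^c$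 is a spherical polytope with finitely many, transcendental vertices: there are $v_1,\dots,v_m\in\mathrm{Hom}(G,\mathbb R)$ and a linear functional $f$ with $f(v_j)>0$ for all $j$, such that $P=\{[v] : 0\neq v=\sum_j a_jv_j,\ a_j\ge 0\}$, no $v_i$ is a nonnegative linear combination of the $v_j$ with $j\ne i$, and for each $j$ and all nonzero $a,b$ in the image of $v_j$, the number $a/b$ is rational or transcendental. -/

import Mathlib

/-- `G` and `Γ` are (abstractly) commensurable: they have isomorphic subgroups of finite index. -/
def GroupsCommensurable (G Γ : Type*) [Group G] [Group Γ] : Prop :=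
  ∃ (H : Subgroup G) (K : Subgroup Γ), H.FiniteIndex ∧ K.FiniteIndex ∧ Nonempty (H ≃* K)

/-- The relation of `φ`-twisted conjugacy: `α` is equivalent to `σ * α * (φ σ)⁻¹`. -/
def twistedConj {G : Type*} [Group G] (φ : G →* G) : Setoid G where
  r α β := ∃ σ : G, β = σ * α * (φ σ)⁻¹
  iseqv :=
    { refl := fun α => ⟨1, by simp⟩
      symm := by
        rintro α β ⟨σ, rfl⟩
        exact ⟨σ⁻¹, by simp [mul_assoc]⟩
      trans := by
        rintro α β γ ⟨σ, rfl⟩ ⟨τ, rfl⟩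
        exact ⟨τ * σ, by simp [mul_assoc]⟩ }

/-- Property `R_∞`: every automorphism has infinitely many twisted conjugacy classes. -/
def HasPropertyRInfty (G : Type*) [Group G] : Prop :=
  ∀ φ : G ≃* G, Infinite (Quotient (twistedConj φ.toMonoidHom))

/-- The first Betti number: the `ℤ`-rank of the abelianization. -/
noncomputable def firstBetti (G : Type*) [Group G] : ℕ :=
  Module.finrank ℤ (Additive (Abelianization G))

/-- `Hom(G, ℝ)`, the real vector space of homomorphisms from `G` to the additive group `ℝ`. -/
abbrev RealCharacter (G : Type*) [Group G] : Type _ := Additive G →+ ℝ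

/-- The topology of pointwise convergence on `Hom(G, ℝ)`; for finitely generated `G` it is the
usual topology of a finite-dimensional real vector space. -/
instance RealCharacter.instTopologicalSpace (G : Type*) [Group G] :
    TopologicalSpace (RealCharacter G) :=
  TopologicalSpace.induced (fun (χ : RealCharacter G) (g : G) => χ (Additive.ofMul g)) inferInstance

/-- The character sphere `S(G)`: nonzero characters up to multiplication by a positive real. -/
abbrev CharacterSphere (G : Type*) [Group G] : Type _ := Module.Ray ℝ (RealCharacter G)

/-- The quotient topology from `Hom(G, ℝ) ∖ {0}`. -/
instance CharacterSphere.instTopologicalSpace (G : Type*) [Group G] :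
    TopologicalSpace (CharacterSphere G) :=
  TopologicalSpace.coinduced
    (fun χ : {χ : RealCharacter G // χ ≠ 0} => rayOfNeZero ℝ χ.1 χ.2) inferInstance

/-- The subgraph `Γ_χ` of the Cayley graph of `G` with respect to `S` that is spanned by the
vertices `g` with `χ(g) ≥ 0`. -/
def cayleyHalf {G : Type*} [Group G] (S : Set G) (χ : RealCharacter G) :
    SimpleGraph {g : G | 0 ≤ χ (Additive.ofMul g)} :=
  (SimpleGraph.mulCayley S).induce {g : G | 0 ≤ χ (Additive.ofMul g)}

/-- The Bieri–Neumann–Strebel invariant `Σ¹(G)`: the classes `[χ]` such that `Γ_χ` is connected,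
the Cayley graph being taken with respect to a finite generating set. (For a finitely generated
group the condition does not depend on the finite generating set.) -/
def sigmaOne (G : Type*) [Group G] : Set (CharacterSphere G) :=
  {ξ | ∃ (χ : RealCharacter G) (hχ : χ ≠ 0), rayOfNeZero ℝ χ hχ = ξ ∧
    ∃ S : Finset G, Subgroup.closure (S : Set G) = ⊤ ∧ (cayleyHalf (S : Set G) χ).Connected}

/-- The open hemisphere `H_g⁺ = {[χ] | χ(g) > 0}`; the opposite one is `H_{g⁻¹}⁺`. -/
def openHemisphere {G : Type*} [Group G] (g : G) : Set (CharacterSphere G) :=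
  {ξ | ∃ (χ : RealCharacter G) (hχ : χ ≠ 0), rayOfNeZero ℝ χ hχ = ξ ∧ 0 < χ (Additive.ofMul g)}

/-- A character is transcendental if the quotient of any two nonzero elements of its image is
rational or transcendental. -/
def RealCharacter.IsTranscendental {G : Type*} [Group G] (χ : RealCharacter G) : Prop :=
  ∀ a ∈ Set.range χ, ∀ b ∈ Set.range χ, a ≠ 0 → b ≠ 0 →
    (∃ q : ℚ, (q : ℝ) = a / b) ∨ Transcendental ℚ (a / b)

/-- `P` is the spherical polytope with vertices `[v 0], …, [v (m - 1)]`: the `v i` lie in an open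
half-space, `P` consists of the rays spanned by the nonzero vectors `∑ a i • v i` with all
`a i ≥ 0`, and the family is minimal, no `v i` being such a combination of the others. -/
structure IsSphericalPolytope {V : Type*} [AddCommGroup V] [Module ℝ V] {m : ℕ} (v : Fin m → V)
    (P : Set (Module.Ray ℝ V)) : Prop where
  halfSpace : ∃ f : V →ₗ[ℝ] ℝ, ∀ i, 0 < f (v i)
  eq_cone : P = {ξ | ∃ (w : V) (hw : w ≠ 0), rayOfNeZero ℝ w hw = ξ ∧
    ∃ a : Fin m → ℝ, (∀ i, 0 ≤ a i) ∧ w = ∑ i, a i • v i}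
  minimal : ∀ i, ¬ ∃ a : Fin m → ℝ, (∀ j, 0 ≤ a j) ∧ a i = 0 ∧ v i = ∑ j, a j • v j

/-- The class `𝒮` of finitely generated groups `G` such that `Σ¹(G)ᶜ` is nonempty and lies in an
open hemisphere, and such that each connected component of `Σ¹(G)ᶜ` is a spherical polytope (with
finitely many vertices) whose vertices are transcendental. -/
structure InClassS (G : Type*) [Group G] : Prop where
  fg : Group.FG G
  nonempty : (sigmaOne G)ᶜ.Nonempty
  hemisphere : ∃ g : G, g ∉ commutator G ∧ (sigmaOne G)ᶜ ⊆ openHemisphere g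
  polytopes : ∀ ξ ∈ (sigmaOne G)ᶜ, ∃ (m : ℕ) (v : Fin m → RealCharacter G),
    IsSphericalPolytope v (connectedComponentIn (sigmaOne G)ᶜ ξ) ∧
      ∀ i, (v i).IsTranscendental

/-!
Let `φ` be an automorphism of a group `G'` commensurable to `G`. A characteristic subgroup `N` of
finite index in `G'` is isomorphic to a subgroup of finite index in `G`, and a nonzero character
of `N` that is fixed by `φ` yields infinitely many `φ`-twisted conjugacy classes of `G'`
(`infinite_twistedConj_of_character`). So it suffices that every automorphism `φ` of a subgroup
`K ≤ G` of finite index fixes a nonzero character (`exists_invariant_character`).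

Since `b₁(K) = b₁(G)`, restriction identifies `Hom(G, ℝ)` with `Hom(K, ℝ)`, and by
`RealCharacter.isSigma_restrict_iff` it identifies `Σ¹(G)` with `Σ¹(K)`. So `φ` induces a linear
automorphism `L` of `Hom(G, ℝ)` that preserves `Σ¹(G)`. Suppose that a power of `L` maps a
component of `Σ¹(G)ᶜ` to itself. It permutes the finitely many vertices of this polytope, so a
further power has some vertex `v` as an eigenvector, with a positive eigenvalue
(`IsSphericalPolytope.exists_eigen_vertex`). The eigenvalue is a unit among the algebraic
integers, because multiplication by it preserves the finitely generated image of `v`; as `v` is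
transcendental, the eigenvalue is rational, hence `1` (`scaling_eq_one`). The sum over the finite
`L`-orbit of `v` is fixed by `L`, and it does not vanish because the orbit lies in an open
hemisphere.

Although `Σ¹(G)ᶜ` may have infinitely many components, some component is mapped to itself by a
power of `L` (`exists_invariant_component`). This is a fact about linear maps `L` that preserve a
nonempty closed cone `C` (`exists_preconnected_of_invariant_cone`); the cone is closed because
`Σ¹(G)` is open (`RealCharacter.IsSigma.eventually`). In an `L`-invariant subspace that meets `C`
and is minimal with this property, every complex eigenfunctional of `L` is nonzero throughout `C`,
because its kernel is invariant. By compactness all eigenfunctionals grow along the orbit of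
`x ∈ C` like the norm, so that `L` is diagonalizable over `ℂ`, with all eigenvalues of the same
modulus `μ`. The values of a functional along the sequence `μ⁻ⁿ Lⁿ x` are then linear combinations
of sequences `ρⁿ`, where `ρ` ranges over a finitely generated group of complex numbers of modulus
one. If `k` is an exponent of its torsion, then no clopen subset of the orbit closure separates
`x` from `μ⁻ᵏ Lᵏ x` (`orbit_mem_connectedComponent`): by the Stone–Weierstrass theorem, its
indicator function along the orbit is a uniform limit of such combinations, so it is periodic by
recurrence, and averaging over a period shows that only torsion frequencies contribute.
-/

/-! ### Paths in Cayley graphs and the invariant `Σ¹` -/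

/-- There is a path from `g` to `h` in the Cayley graph of `G` with respect to `S` all of whose
vertices lie in `A`. (The constant path is allowed even if `g = h` is not in `A`.) -/
def CayleyPath {G : Type*} [Group G] (S A : Set G) : G → G → Prop :=
  Relation.ReflTransGen fun x y => x ∈ A ∧ y ∈ A ∧ ∃ s ∈ S, x * s = y ∨ x = y * s

namespace CayleyPath

variable {G : Type*} [Group G] {S A B : Set G} {g h k : G}

lemma refl (g : G) : CayleyPath S A g g := Relation.ReflTransGen.refl

lemma trans (h₁ : CayleyPath S A g h) (h₂ : CayleyPath S A h k) : CayleyPath S A g k :=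
  Relation.ReflTransGen.trans h₁ h₂

lemma symm (h₁ : CayleyPath S A g h) : CayleyPath S A h g := by
  have : Std.Symm fun x y : G => x ∈ A ∧ y ∈ A ∧ ∃ s ∈ S, x * s = y ∨ x = y * s := by
    refine ⟨?_⟩
    rintro x y ⟨hx, hy, s, hs, hxy⟩
    exact ⟨hy, hx, s, hs, hxy.symm.imp Eq.symm Eq.symm⟩
  exact Relation.ReflTransGen.stdSymm.symm _ _ h₁

lemma edge (hg : g ∈ A) (hh : h ∈ A) {s : G} (hs : s ∈ S) (e : g * s = h ∨ g = h * s) :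
    CayleyPath S A g h :=
  Relation.ReflTransGen.single ⟨hg, hh, s, hs, e⟩

/-- Left translation by `a` moves a path. -/
lemma translate (a : G) (hAB : ∀ x ∈ A, a * x ∈ B) (h₁ : CayleyPath S A g h) :
    CayleyPath S B (a * g) (a * h) := by
  refine Relation.ReflTransGen.lift (fun x => a * x) ?_ _ _ h₁
  rintro x y ⟨hx, hy, s, hs, e⟩
  refine ⟨hAB x hx, hAB y hy, s, hs, ?_⟩
  rcases e with rfl | rfl <;> simp [mul_assoc]

lemma mono {T : Set G} (hST : S ⊆ T) (hAB : A ⊆ B) (h₁ : CayleyPath S A g h) :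
    CayleyPath T B g h := by
  refine Relation.ReflTransGen.mono ?_ _ _ h₁
  rintro x y ⟨hx, hy, s, hs, e⟩
  exact ⟨hAB hx, hAB hy, s, hST hs, e⟩

end CayleyPath

section Sigma

variable {G : Type*} [Group G]

@[simp] lemma RealCharacter.map_mul (χ : RealCharacter G) (g h : G) :
    χ (Additive.ofMul (g * h)) = χ (Additive.ofMul g) + χ (Additive.ofMul h) := by
  rw [ofMul_mul, map_add]

@[simp] lemma RealCharacter.map_one' (χ : RealCharacter G) : χ (Additive.ofMul (1 : G)) = 0 := by
  rw [ofMul_one, map_zero]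

@[simp] lemma RealCharacter.map_inv (χ : RealCharacter G) (g : G) :
    χ (Additive.ofMul g⁻¹) = - χ (Additive.ofMul g) := by
  rw [ofMul_inv, map_neg]

lemma RealCharacter.map_pow (χ : RealCharacter G) (g : G) (n : ℕ) :
    χ (Additive.ofMul (g ^ n)) = n * χ (Additive.ofMul g) := by
  rw [ofMul_pow, map_nsmul, nsmul_eq_mul]

lemma RealCharacter.ne_zero_iff {χ : RealCharacter G} :
    χ ≠ 0 ↔ ∃ g : G, χ (Additive.ofMul g) ≠ 0 := by
  rw [Ne, DFunLike.ext_iff, not_forall]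
  rfl

/-- `[χ] ∈ Σ¹(G)`, as a condition on the character `χ`: with respect to some finite generating
set, every `g` with `χ(g) ≥ 0` is joined to `1` by a path that stays in `{χ ≥ 0}`. -/
def RealCharacter.IsSigma (χ : RealCharacter G) : Prop :=
  ∃ S : Finset G, Subgroup.closure (S : Set G) = ⊤ ∧
    ∀ g, 0 ≤ χ (Additive.ofMul g) → CayleyPath (S : Set G) {x | 0 ≤ χ (Additive.ofMul x)} 1 g

lemma cayleyHalf_connected_iff (S : Set G) (χ : RealCharacter G) :
    (cayleyHalf S χ).Connected ↔
      ∀ g, 0 ≤ χ (Additive.ofMul g) → CayleyPath S {x | 0 ≤ χ (Additive.ofMul x)} 1 g := by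
  have key : ∀ u v : {g : G | 0 ≤ χ (Additive.ofMul g)}, (cayleyHalf S χ).Reachable u v ↔
      CayleyPath S {x | 0 ≤ χ (Additive.ofMul x)} (u : G) v := by
    intro u v
    rw [SimpleGraph.reachable_iff_reflTransGen]
    constructor
    · intro h
      refine Relation.ReflTransGen.lift Subtype.val ?_ _ _ h
      rintro x y hxy
      have := (SimpleGraph.mulCayley_adj' S x.1 y.1).1 hxy
      exact ⟨x.2, y.2, this.2⟩
    · intro h
      obtain ⟨u, hu⟩ := u
      obtain ⟨v, hv⟩ := v
      change CayleyPath S {x | 0 ≤ χ (Additive.ofMul x)} u v at h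
      induction h with
      | refl => exact Relation.ReflTransGen.refl
      | @tail b c h₁ h₂ ih =>
        by_cases hbc : b = c
        · subst hbc; exact ih hv
        · refine (ih h₂.1).tail ?_
          exact (SimpleGraph.mulCayley_adj' S b c).2 ⟨hbc, h₂.2.2⟩
  constructor
  · intro h g hg
    exact (key ⟨1, by simp⟩ ⟨g, hg⟩).1 (h.preconnected _ _)
  · intro h
    have : Nonempty {g : G | 0 ≤ χ (Additive.ofMul g)} := ⟨⟨1, by simp⟩⟩
    refine ⟨fun u v => (key u v).2 ?_⟩
    exact (h u u.2).symm.trans (h v v.2)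

lemma RealCharacter.IsSigma.smul {χ : RealCharacter G} (h : χ.IsSigma) {c : ℝ} (hc : 0 < c) :
    (c • χ).IsSigma := by
  obtain ⟨S, hS, h⟩ := h
  have e : ∀ g : G, 0 ≤ (c • χ) (Additive.ofMul g) ↔ 0 ≤ χ (Additive.ofMul g) := fun g => by
    rw [AddMonoidHom.smul_apply, smul_eq_mul, mul_nonneg_iff_of_pos_left hc]
  refine ⟨S, hS, fun g hg => ?_⟩
  simp only [e] at hg ⊢
  exact h g hg

lemma rayOfNeZero_mem_sigmaOne {χ : RealCharacter G} (hχ : χ ≠ 0) :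
    rayOfNeZero ℝ χ hχ ∈ sigmaOne G ↔ χ.IsSigma := by
  constructor
  · rintro ⟨χ', hχ', e, S, hS, hc⟩
    have h : χ'.IsSigma := ⟨S, hS, (cayleyHalf_connected_iff _ _).1 hc⟩
    rw [ray_eq_iff, exists_pos_left_iff_sameRay hχ' hχ |>.symm] at e
    obtain ⟨c, hc, rfl⟩ := e
    exact h.smul hc
  · rintro ⟨S, hS, h⟩
    exact ⟨χ, hχ, rfl, S, hS, (cayleyHalf_connected_iff _ _).2 h⟩

lemma RealCharacter.IsSigma.comp_mulEquiv {H : Type*} [Group H] {χ : RealCharacter H}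
    (h : χ.IsSigma) (e : G ≃* H) :
    RealCharacter.IsSigma (χ.comp e.toMonoidHom.toAdditive) := by
  classical
  obtain ⟨S, hS, h⟩ := h
  refine ⟨S.image e.symm, ?_, fun g hg => ?_⟩
  · have := congrArg (Subgroup.map e.symm.toMonoidHom) hS
    rw [MonoidHom.map_closure, Subgroup.map_top_of_surjective _ e.symm.surjective] at this
    simpa using this
  · have h1 := h (e g) hg
    have : CayleyPath ((S.image e.symm : Finset G) : Set G)
        {x | 0 ≤ (χ.comp e.toMonoidHom.toAdditive) (Additive.ofMul x)} (e.symm 1)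
        (e.symm (e g)) := by
      refine Relation.ReflTransGen.lift e.symm ?_ _ _ h1
      rintro x y ⟨hx, hy, s, hs, hxy⟩
      refine ⟨?_, ?_, e.symm s, ?_, ?_⟩
      · change 0 ≤ χ (Additive.ofMul (e (e.symm x))); rwa [e.apply_symm_apply]
      · change 0 ≤ χ (Additive.ofMul (e (e.symm y))); rwa [e.apply_symm_apply]
      · simpa using hs
      · rcases hxy with rfl | rfl <;> simp
    simpa using this

lemma CayleyPath.of_mem_closure {S : Set G} {g : G} (hg : g ∈ Subgroup.closure S) :
    CayleyPath S Set.univ 1 g := by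
  induction hg using Subgroup.closure_induction with
  | mem x hx => exact .edge trivial trivial hx (Or.inl (one_mul x))
  | one => exact .refl _
  | mul x y _ _ hx hy =>
    have := hy.translate (B := Set.univ) x (fun _ _ => trivial)
    rw [mul_one] at this
    exact hx.trans this
  | inv x _ hx =>
    have := hx.translate (B := Set.univ) x⁻¹ (fun _ _ => trivial)
    rw [mul_one, inv_mul_cancel] at this
    exact this.symm

lemma CayleyPath.exists_lower_bound {S A : Set G} {g h : G} (χ : RealCharacter G)
    (p : CayleyPath S A g h) : ∃ c : ℝ, CayleyPath S {x | c ≤ χ (Additive.ofMul x)} g h := by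
  induction p with
  | refl => exact ⟨0, .refl _⟩
  | @tail a b _ e ih =>
    obtain ⟨c, hc⟩ := ih
    refine ⟨min c (min (χ (Additive.ofMul a)) (χ (Additive.ofMul b))), ?_⟩
    refine CayleyPath.trans 
      (hc.mono subset_rfl fun x (hx : c ≤ _) => show _ ≤ _ from (min_le_left _ _).trans hx) ?_
    exact Relation.ReflTransGen.single ⟨
      show _ ≤ χ (Additive.ofMul a) from (min_le_right _ _).trans (min_le_left _ _),
      show _ ≤ χ (Additive.ofMul b) from (min_le_right _ _).trans (min_le_right _ _), e.2.2⟩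

open Filter Topology in
/-- If each vertex in `A₀` lies in `A i` eventually along `l`, then so does each path, because it
has finitely many vertices. -/
lemma CayleyPath.eventually {ι : Type*} {l : Filter ι} {S A₀ : Set G} {A : ι → Set G} {g h : G}
    (hA : ∀ x ∈ A₀, ∀ᶠ i in l, x ∈ A i) (p : CayleyPath S A₀ g h) :
    ∀ᶠ i in l, CayleyPath S (A i) g h := by
  induction p with
  | refl => exact Eventually.of_forall fun _ => .refl _
  | tail _ e ih =>
    filter_upwards [ih, hA _ e.1, hA _ e.2.1] with i h₁ h₂ h₃
    exact h₁.trans (Relation.ReflTransGen.single ⟨h₂, h₃, e.2.2⟩)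

open Filter Topology in
/-- The criterion of Bieri, Neumann and Strebel: if `t` is a generator or the inverse of one,
`χ(t) > 0`, and for each generator `s` the edge from `1` to `s` can be pushed up along `t`, i.e.
`t` is joined to `st` by a path on which `χ` exceeds its minimum on `{1, s}`, then
`[χ] ∈ Σ¹(G)`. -/
lemma RealCharacter.isSigma_of_paths {χ : RealCharacter G} {S : Finset G}
    (hS : Subgroup.closure (S : Set G) = ⊤) {t : G} (ht : 0 < χ (Additive.ofMul t))
    (htS : ∃ s ∈ S, t = s ∨ t = s⁻¹)
    (hp : ∀ s ∈ S, CayleyPath (S : Set G)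
      {x | min 0 (χ (Additive.ofMul s)) < χ (Additive.ofMul x)} t (s * t)) : χ.IsSigma := by
  obtain ⟨δ, hδ, hpδ⟩ : ∃ δ : ℝ, 0 < δ ∧ ∀ s ∈ S, CayleyPath (S : Set G)
      {x | min 0 (χ (Additive.ofMul s)) + δ ≤ χ (Additive.ofMul x)} t (s * t) := by
    have h1 : ∀ᶠ δ : ℝ in 𝓝[>] 0, ∀ s ∈ S, CayleyPath (S : Set G)
        {x | min 0 (χ (Additive.ofMul s)) + δ ≤ χ (Additive.ofMul x)} t (s * t) := by
      rw [Filter.eventually_all_finset]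
      intro s hs
      refine (hp s hs).eventually fun x hx => ?_
      have hx' : 0 < χ (Additive.ofMul x) - min 0 (χ (Additive.ofMul s)) := sub_pos.2 hx
      filter_upwards [Ioo_mem_nhdsGT hx'] with δ hδ
      have := hδ.2
      change _ ≤ _
      linarith
    obtain ⟨δ, h2, h3⟩ := (h1.and self_mem_nhdsWithin).exists
    exact ⟨δ, h3, h2⟩
  have edge_t : ∀ x : G, ∃ s ∈ S, x * s = x * t ∨ x = x * t * s := by
    intro x
    obtain ⟨s, hs, rfl | rfl⟩ := htS
    · exact ⟨_, hs, Or.inl rfl⟩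
    · exact ⟨s, hs, Or.inr (by simp)⟩
  -- Pushing a path up along `t` raises its minimum by `δ`, as long as the minimum is negative.
  have step : ∀ (c : ℝ) (g : G), 0 ≤ χ (Additive.ofMul g) →
      CayleyPath (S : Set G) {x | c ≤ χ (Additive.ofMul x)} 1 g →
      CayleyPath (S : Set G) {x | min 0 (c + δ) ≤ χ (Additive.ofMul x)} 1 g := by
    intro c g hg p
    have pushed : CayleyPath (S : Set G) {x | c + δ ≤ χ (Additive.ofMul x)} (1 * t) (g * t) := by
      clear hg
      have aux : ∀ x s, s ∈ S → c ≤ χ (Additive.ofMul x) → c ≤ χ (Additive.ofMul (x * s)) →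
          CayleyPath (S : Set G) {x | c + δ ≤ χ (Additive.ofMul x)} (x * t) (x * s * t) := by
        intro x s hs h1 h2
        rw [mul_assoc]
        refine (hpδ s hs).translate x fun y hy => ?_
        simp only [Set.mem_ofPred_eq, RealCharacter.map_mul] at hy h2 ⊢
        rcases min_choice 0 (χ (Additive.ofMul s)) with h | h <;> rw [h] at hy <;> linarith
      induction p with
      | refl => exact .refl _
      | @tail a b _ e ih =>
        obtain ⟨ha, hb, s, hs, rfl | rfl⟩ := e
        · exact ih.trans (aux a s hs ha hb)
        · exact ih.trans (aux b s hs hb ha).symm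
    have hgt : 0 ≤ χ (Additive.ofMul (g * t)) := by
      rw [RealCharacter.map_mul]; linarith
    have low : ∀ {x : G}, 0 ≤ χ (Additive.ofMul x) → min 0 (c + δ) ≤ χ (Additive.ofMul x) :=
      fun h => (min_le_left _ _).trans h
    obtain ⟨s, hs, e⟩ := edge_t 1
    obtain ⟨s', hs', e'⟩ := edge_t g
    have h1 : CayleyPath (S : Set G) {x | min 0 (c + δ) ≤ χ (Additive.ofMul x)} 1 (1 * t) :=
      .edge (low (by simp)) (low (by simpa using ht.le)) hs e
    have h3 : CayleyPath (S : Set G) {x | min 0 (c + δ) ≤ χ (Additive.ofMul x)} g (g * t) :=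
      .edge (low hg) (low hgt) hs' e'
    exact (h1.trans (pushed.mono subset_rfl fun x (hx : c + δ ≤ _) =>
      show _ ≤ _ from (min_le_right _ _).trans hx)).trans h3.symm
  refine ⟨S, hS, fun g hg => ?_⟩
  obtain ⟨c, hc⟩ := (CayleyPath.of_mem_closure (S := (S : Set G)) (g := g)
    (hS ▸ Subgroup.mem_top g)).exists_lower_bound χ
  have iter : ∀ n : ℕ,
      CayleyPath (S : Set G) {x | min 0 (c + n * δ) ≤ χ (Additive.ofMul x)} 1 g := by
    intro n
    induction n with
    | zero =>
      refine hc.mono subset_rfl fun x hx => ?_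
      simp only [Set.mem_ofPred_eq, Nat.cast_zero, zero_mul, add_zero] at hx ⊢
      exact (min_le_right _ _).trans hx
    | succ n ih =>
      refine (step _ g hg ih).mono subset_rfl fun x hx => ?_
      simp only [Set.mem_ofPred_eq] at hx ⊢
      refine le_trans ?_ hx
      refine le_min (min_le_left _ _) ?_
      rw [← min_add_add_right]
      refine le_min ((min_le_left _ _).trans (by linarith)) ((min_le_right _ _).trans ?_)
      push_cast; linarith
  obtain ⟨n, hn⟩ := exists_nat_gt (-c / δ)
  have hn' : 0 ≤ c + n * δ := by
    rw [div_lt_iff₀ hδ] at hn; linarith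
  have := iter n
  rwa [min_eq_left hn'] at this

open Topology

lemma RealCharacter.continuous_eval (g : G) :
    Continuous fun χ : RealCharacter G => χ (Additive.ofMul g) :=
  (continuous_apply g).comp continuous_induced_dom

/-- `Σ¹(G)` is open: the criterion `RealCharacter.isSigma_of_paths` consists of finitely many
strict inequalities. -/
theorem RealCharacter.IsSigma.eventually {χ : RealCharacter G} (h : χ.IsSigma) (hχ : χ ≠ 0) :
    ∀ᶠ χ' in 𝓝 χ, χ'.IsSigma := by
  obtain ⟨S, hS, h⟩ := h
  obtain ⟨t, ht, htS⟩ : ∃ t : G, 0 < χ (Additive.ofMul t) ∧ ∃ s ∈ S, t = s ∨ t = s⁻¹ := by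
    by_contra! hcon
    refine hχ (DFunLike.ext _ _ fun x => ?_)
    have hx : x.toMul ∈ Subgroup.closure (S : Set G) := hS ▸ Subgroup.mem_top _
    change χ (Additive.ofMul x.toMul) = 0
    generalize x.toMul = g at hx
    induction hx using Subgroup.closure_induction with
    | mem s hs =>
      refine le_antisymm ?_ ?_
      · by_contra! h0
        exact (hcon s h0 s hs).1 rfl
      · by_contra! h0
        exact (hcon s⁻¹ (by simpa using h0) s hs).2 rfl
    | one => simp
    | mul a b _ _ ha hb => simp [ha, hb]
    | inv a _ ha => simp [ha]
  have hp : ∀ s ∈ S, CayleyPath (S : Set G)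
      {x | min 0 (χ (Additive.ofMul s)) < χ (Additive.ofMul x)} t (s * t) := by
    intro s hs
    rcases le_total 0 (χ (Additive.ofMul s)) with h0 | h0
    · have := (h (t⁻¹ * (s * t)) (by simpa using h0)).translate (B :=
        {x | min 0 (χ (Additive.ofMul s)) < χ (Additive.ofMul x)}) t (fun x hx => by
          simp only [Set.mem_ofPred_eq, RealCharacter.map_mul] at hx ⊢
          rw [min_eq_left h0]; linarith)
      simpa using this
    · have := (h (t⁻¹ * (s⁻¹ * t)) (by simpa using h0)).translate (B :=
        {x | min 0 (χ (Additive.ofMul s)) < χ (Additive.ofMul x)}) (s * t) (fun x hx => by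
          simp only [Set.mem_ofPred_eq, RealCharacter.map_mul] at hx ⊢
          rw [min_eq_right h0]; linarith)
      have e : s * t * (t⁻¹ * (s⁻¹ * t)) = t := by group
      rw [e, mul_one] at this
      exact this.symm
  have h1 : ∀ᶠ χ' in 𝓝 χ, ∀ s ∈ S, CayleyPath (S : Set G)
      {x | min 0 (χ' (Additive.ofMul s)) < χ' (Additive.ofMul x)} t (s * t) := by
    rw [Filter.eventually_all_finset]
    intro s hs
    refine (hp s hs).eventually fun x hx => ?_
    exact (continuousAt_const.min (RealCharacter.continuous_eval s).continuousAt).eventually_lt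
      (RealCharacter.continuous_eval x).continuousAt hx
  have h2 : ∀ᶠ χ' in 𝓝 χ, 0 < χ' (Additive.ofMul t) :=
    (RealCharacter.continuous_eval t).continuousAt.eventually (lt_mem_nhds ht)
  filter_upwards [h1, h2] with χ' h3 h4
  exact RealCharacter.isSigma_of_paths hS h4 htS h3

/-- The restriction of characters to a subgroup. -/
def RealCharacter.restrict (H : Subgroup G) (χ : RealCharacter G) : RealCharacter H :=
  χ.comp H.subtype.toAdditive

@[simp] lemma RealCharacter.restrict_apply (H : Subgroup G) (χ : RealCharacter G) (h : H) :
    χ.restrict H (Additive.ofMul h) = χ (Additive.ofMul (h : G)) := rfl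

lemma RealCharacter.exists_mem_neg (H : Subgroup G) [H.FiniteIndex] {χ : RealCharacter G}
    (hχ : χ ≠ 0) : ∃ h ∈ H, χ (Additive.ofMul h) < 0 := by
  obtain ⟨g, hg⟩ := RealCharacter.ne_zero_iff.1 hχ
  obtain ⟨n, hn, -, hgn⟩ := Subgroup.exists_pow_mem_of_index_ne_zero
    (H := H) Subgroup.FiniteIndex.index_ne_zero g
  have hne : χ (Additive.ofMul (g ^ n)) ≠ 0 := by
    rw [RealCharacter.map_pow]
    exact mul_ne_zero (by exact_mod_cast hn.ne') hg
  rcases lt_or_gt_of_ne hne with h | h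
  · exact ⟨_, hgn, h⟩
  · exact ⟨_, H.inv_mem hgn, by simpa using h⟩

/-- A nonzero character `χ` admits representatives `τ g` of the right cosets `Hg` of a subgroup
of finite index with `χ(τ g) ≤ 0`. -/
lemma RealCharacter.exists_coset_representatives (H : Subgroup G) [H.FiniteIndex]
    {χ : RealCharacter G} (hχ : χ ≠ 0) : ∃ τ : G → G, (Set.range τ).Finite ∧
      (∀ g, g * (τ g)⁻¹ ∈ H) ∧ (∀ g, χ (Additive.ofMul (τ g)) ≤ 0) ∧ ∀ h ∈ H, τ h = 1 := by
  classical
  obtain ⟨h₀, hh₀, hneg⟩ := RealCharacter.exists_mem_neg H hχ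
  have hrep : ∀ q : Quotient (QuotientGroup.rightRel H), ∃ t : G,
      Quotient.mk _ t = q ∧ χ (Additive.ofMul t) ≤ 0 ∧ (q = Quotient.mk _ 1 → t = 1) := by
    intro q
    by_cases hq : q = Quotient.mk _ 1
    · exact ⟨1, hq.symm, by simp, fun _ => rfl⟩
    · induction q using Quotient.inductionOn with
      | h g =>
        obtain ⟨n, hn⟩ := exists_nat_gt (χ (Additive.ofMul g) / -χ (Additive.ofMul h₀))
        refine ⟨h₀ ^ n * g, ?_, ?_, fun h => absurd h hq⟩
        · apply Quotient.sound
          change QuotientGroup.rightRel H _ _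
          rw [QuotientGroup.rightRel_apply]
          simpa using H.inv_mem (H.pow_mem hh₀ n)
        · rw [div_lt_iff₀ (by linarith)] at hn
          rw [RealCharacter.map_mul, RealCharacter.map_pow]
          linarith
  choose f hf1 hf2 hf3 using hrep
  have hfin : Finite (Quotient (QuotientGroup.rightRel H)) :=
    Finite.of_equiv _ (QuotientGroup.quotientRightRelEquivQuotientLeftRel H).symm
  refine ⟨fun g => f (Quotient.mk _ g), ?_, fun g => ?_, fun g => hf2 _, fun h hh => hf3 _ ?_⟩
  · exact (Set.finite_range f).subset (Set.range_comp_subset_range _ _)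
  · have := Quotient.exact (hf1 (Quotient.mk _ g))
    change QuotientGroup.rightRel H _ _ at this
    rwa [QuotientGroup.rightRel_apply] at this
  · apply Quotient.sound
    change QuotientGroup.rightRel H _ _
    rw [QuotientGroup.rightRel_apply]
    simpa using H.inv_mem hh

lemma RealCharacter.IsSigma.of_restrict (H : Subgroup G) [H.FiniteIndex] {χ : RealCharacter G}
    (hχ : χ ≠ 0) (h : (χ.restrict H).IsSigma) : χ.IsSigma := by
  classical
  obtain ⟨τ, hfin, hτH, hτ, -⟩ := RealCharacter.exists_coset_representatives H hχ
  obtain ⟨S, hS, h⟩ := h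
  set S' : Finset G := S.image (↑) ∪ hfin.toFinset with hS'
  have hτS : ∀ g, τ g ∈ S' := fun g => by simp [hS']
  have hHS : H ≤ Subgroup.closure (S' : Set G) := by
    have := congrArg (Subgroup.map H.subtype) hS
    rw [MonoidHom.map_closure, ← MonoidHom.range_eq_map, Subgroup.range_subtype] at this
    rw [← this]
    apply Subgroup.closure_mono
    rintro _ ⟨s, hs, rfl⟩
    have : (s : G) ∈ S' := Finset.mem_union_left _ (Finset.mem_image_of_mem _ hs)
    exact this
  refine ⟨S', ?_, fun g hg => ?_⟩
  · rw [eq_top_iff]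
    intro g _
    have := mul_mem (hHS (hτH g)) (Subgroup.subset_closure (hτS g))
    simpa using this
  · have h0 : 0 ≤ χ (Additive.ofMul (g * (τ g)⁻¹)) := by
      have := hτ g
      rw [RealCharacter.map_mul, RealCharacter.map_inv]
      linarith
    have h1 := h ⟨g * (τ g)⁻¹, hτH g⟩ h0
    have h2 : CayleyPath (S' : Set G) {x | 0 ≤ χ (Additive.ofMul x)} ((1 : H) : G)
        (g * (τ g)⁻¹) := by
      refine Relation.ReflTransGen.lift (fun x : H => (x : G)) ?_ _ _ h1
      rintro x y ⟨hx, hy, s, hs, e⟩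
      refine ⟨hx, hy, s, Finset.mem_union_left _ (Finset.mem_image_of_mem _ hs), ?_⟩
      exact e.imp (congrArg Subtype.val) (congrArg Subtype.val)
    exact h2.trans (.edge h0 hg (hτS g) (Or.inl (by simp)))

/-- A path in `{χ ≥ 0}` is projected to `H` along coset representatives on which `χ ≤ 0`, and so
stays in `{χ ≥ 0}`; its edges become Schreier generators. -/
lemma RealCharacter.IsSigma.restrict (H : Subgroup G) [H.FiniteIndex] {χ : RealCharacter G}
    (hχ : χ ≠ 0) (h : χ.IsSigma) : (χ.restrict H).IsSigma := by
  classical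
  obtain ⟨τ, hfin, hτH, hτ, hτ1⟩ := RealCharacter.exists_coset_representatives H hχ
  obtain ⟨S, hS, h⟩ := h
  let Y : Set H := {y | ∃ a ∈ Set.range τ, ∃ b ∈ Set.range τ, ∃ s ∈ S, (y : G) = a * s * b⁻¹}
  have hY : Y.Finite := by
    have h1 : (Set.image2 (fun (p : G × G) (s : G) => p.1 * s * p.2⁻¹)
      (Set.range τ ×ˢ Set.range τ) S).Finite := (hfin.prod hfin).image2 _ S.finite_toSet
    refine (h1.preimage (f := ((↑) : H → G)) Subtype.val_injective.injOn).subset ?_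
    rintro y ⟨a, ha, b, hb, s, hs, e⟩
    exact ⟨(a, b), ⟨ha, hb⟩, s, hs, e.symm⟩
  let ρ : G → H := fun g => ⟨g * (τ g)⁻¹, hτH g⟩
  have hρ : ∀ h : H, ρ h = h := fun h => Subtype.ext (by simp [ρ, hτ1 _ h.2])
  have hpath : ∀ g : H, 0 ≤ χ.restrict H (Additive.ofMul g) →
      CayleyPath (hY.toFinset : Set H) {x | 0 ≤ χ.restrict H (Additive.ofMul x)} 1 g := by
    intro g hg
    have h1 := h g hg
    rw [← hρ g, ← hρ 1]
    refine Relation.ReflTransGen.lift ρ ?_ _ _ h1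
    have pos : ∀ x : G, 0 ≤ χ (Additive.ofMul x) →
        0 ≤ χ.restrict H (Additive.ofMul (ρ x)) := by
      intro x hx
      have := hτ x
      simp only [RealCharacter.restrict_apply, ρ, RealCharacter.map_mul, RealCharacter.map_inv]
      linarith
    have edge : ∀ x s : G, s ∈ S → (ρ x)⁻¹ * ρ (x * s) ∈ hY.toFinset := by
      intro x s hs
      rw [Set.Finite.mem_toFinset]
      exact ⟨τ x, ⟨x, rfl⟩, τ (x * s), ⟨_, rfl⟩, s, hs, by simp [ρ, mul_assoc]⟩
    rintro x y ⟨hx, hy, s, hs, rfl | rfl⟩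
    · exact ⟨pos _ hx, pos _ hy, _, edge x s hs, Or.inl (by simp)⟩
    · exact ⟨pos _ hx, pos _ hy, _, edge y s hs, Or.inr (by simp)⟩
  have hmem : ∀ g : H, 0 ≤ χ.restrict H (Additive.ofMul g) →
      g ∈ Subgroup.closure (hY.toFinset : Set H) := by
    intro g hg
    have := hpath g hg
    clear hg
    induction this with
    | refl => exact one_mem _
    | tail _ e ih =>
      obtain ⟨-, -, s, hs, rfl | rfl⟩ := e
      · exact mul_mem ih (Subgroup.subset_closure hs)
      · exact (Subgroup.mul_mem_cancel_right _ (Subgroup.subset_closure hs)).1 ih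
  refine ⟨hY.toFinset, ?_, hpath⟩
  rw [eq_top_iff]
  intro g _
  rcases le_total 0 (χ.restrict H (Additive.ofMul g)) with h0 | h0
  · exact hmem g h0
  · exact inv_mem_iff.1 (hmem g⁻¹ (by simpa only [RealCharacter.map_inv, neg_nonneg] using h0))

/-- `Σ¹` of a subgroup of finite index: `[χ] ∈ Σ¹(G)` if and only if `[χ|_H] ∈ Σ¹(H)`. -/
theorem RealCharacter.isSigma_restrict_iff (H : Subgroup G) [H.FiniteIndex] {χ : RealCharacter G}
    (hχ : χ ≠ 0) : (χ.restrict H).IsSigma ↔ χ.IsSigma :=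
  ⟨.of_restrict H hχ, .restrict H hχ⟩

end Sigma

/-! ### Almost periodic sequences with frequencies in a finitely generated group -/

section AlmostPeriodic

open Filter Topology

/-- The span of the sequences `n ↦ ρ ^ n` with `ρ` in a group `Γ` of complex numbers of
modulus one. -/
def trigSequences (Γ : Subgroup Circle) : Submodule ℂ (ℕ → ℂ) :=
  Submodule.span ℂ {f | ∃ ρ ∈ Γ, f = fun n => (ρ : ℂ) ^ n}

lemma exists_torsion_exponent (Γ : Subgroup Circle) (hΓ : Γ.FG) :
    ∃ k : ℕ, 0 < k ∧ ∀ ρ ∈ Γ, IsOfFinOrder ρ → ρ ^ k = 1 := by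
  have : Group.FG Γ := (Group.fg_iff_subgroup_fg Γ).2 hΓ
  have : Module.Finite ℤ (Additive Γ) := Module.Finite.iff_addGroup_fg.2 inferInstance
  have : Finite (Submodule.torsion ℤ (Additive Γ)) :=
    Module.finite_of_fg_torsion _ (Submodule.torsion_isTorsion)
  refine ⟨Nat.card (Submodule.torsion ℤ (Additive Γ)), Nat.card_pos, fun ρ hρ hfin => ?_⟩
  obtain ⟨n, hn, hn1⟩ := isOfFinOrder_iff_pow_eq_one.1 hfin
  have hmem : Additive.ofMul (⟨ρ, hρ⟩ : Γ) ∈ Submodule.torsion ℤ (Additive Γ) := by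
    rw [Submodule.mem_torsion_iff]
    refine ⟨⟨(n : ℤ), mem_nonZeroDivisors_of_ne_zero (by exact_mod_cast hn.ne')⟩, ?_⟩
    change (n : ℤ) • Additive.ofMul (⟨ρ, hρ⟩ : Γ) = 0
    rw [natCast_zsmul, ← ofMul_pow, ofMul_eq_zero]
    exact Subtype.ext hn1
  have h := card_nsmul_eq_zero' (x := (⟨_, hmem⟩ : Submodule.torsion ℤ (Additive Γ)))
  have h2 := congrArg
    (fun z : Submodule.torsion ℤ (Additive Γ) => ((Additive.toMul z.1 : Γ) : Circle)) h
  simpa using h2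

lemma trigSequences_recurrent {Γ : Subgroup Circle} {f : ℕ → ℂ} (hf : f ∈ trigSequences Γ) :
    ∀ ε > 0, ∀ᶠ p : ℕ in comap (fun p => fun ρ : Circle => ρ ^ p) (𝓝 1),
      ∀ n, ‖f (n + p) - f n‖ < ε := by
  induction hf using Submodule.span_induction with
  | mem f hf =>
    obtain ⟨ρ, -, rfl⟩ := hf
    intro ε hε
    have h1 : Tendsto (fun u : Circle → Circle => ‖((u ρ : Circle) : ℂ) - 1‖) (𝓝 1) (𝓝 0) := by
      have : Continuous fun u : Circle → Circle => ‖((u ρ : Circle) : ℂ) - 1‖ := by fun_prop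
      simpa using this.tendsto 1
    filter_upwards [(h1.comp tendsto_comap).eventually (gt_mem_nhds hε)] with p hp n
    have : (ρ : ℂ) ^ (n + p) - (ρ : ℂ) ^ n = (ρ : ℂ) ^ n * (((ρ ^ p : Circle) : ℂ) - 1) := by
      push_cast; ring
    rw [this, norm_mul, norm_pow, Circle.norm_coe, one_pow, one_mul]
    exact hp
  | zero => exact fun ε hε => Eventually.of_forall fun p n => by simpa using hε
  | add f g _ _ hf hg =>
    intro ε hε
    filter_upwards [hf (ε / 2) (half_pos hε), hg (ε / 2) (half_pos hε)] with p h1 h2 n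
    have e : (f + g) (n + p) - (f + g) n = (f (n + p) - f n) + (g (n + p) - g n) := by
      simp only [Pi.add_apply]; ring
    rw [e]
    linarith [norm_add_le (f (n + p) - f n) (g (n + p) - g n), h1 n, h2 n]
  | smul c f _ hf =>
    intro ε hε
    have hc : 0 < ‖c‖ + 1 := by positivity
    filter_upwards [hf (ε / (‖c‖ + 1)) (div_pos hε hc)] with p h1 n
    have e : (c • f) (n + p) - (c • f) n = c * (f (n + p) - f n) := by
      simp only [Pi.smul_apply, smul_eq_mul]; ring
    rw [e, norm_mul]
    have h2 := h1 n
    rw [lt_div_iff₀ hc] at h2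
    nlinarith [norm_nonneg (f (n + p) - f n)]

/-- Averaging over an arithmetic progression of difference `p` kills every frequency `ρ` with
`ρ ^ p ≠ 1`; the other ones are torsion, hence `k`-periodic. -/
lemma trigSequences_average {Γ : Subgroup Circle} {k p : ℕ} (hp : 0 < p)
    (hk : ∀ ρ ∈ Γ, IsOfFinOrder ρ → ρ ^ k = 1) {f : ℕ → ℂ} (hf : f ∈ trigSequences Γ) (n : ℕ) :
    Tendsto (fun N : ℕ => (N : ℂ)⁻¹ * ∑ i ∈ Finset.range N, (f (n + k + p * i) - f (n + p * i)))
      atTop (𝓝 0) := by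
  induction hf using Submodule.span_induction with
  | mem f hf =>
    obtain ⟨ρ, hρ, rfl⟩ := hf
    have e : ∀ i, (ρ : ℂ) ^ (n + k + p * i) - (ρ : ℂ) ^ (n + p * i)
        = (ρ : ℂ) ^ n * ((ρ : ℂ) ^ k - 1) * ((ρ : ℂ) ^ p) ^ i := by
      intro i; rw [← pow_mul]; ring
    simp only [e, ← Finset.mul_sum]
    by_cases h : (ρ : ℂ) ^ p = 1
    · have h1 : ρ ^ p = 1 := Circle.ext (by simpa using h)
      have h2 := hk ρ hρ (isOfFinOrder_iff_pow_eq_one.2 ⟨p, hp, h1⟩)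
      have h3 : (ρ : ℂ) ^ k = 1 := by rw [← Circle.coe_pow, h2, Circle.coe_one]
      simp [h3]
    · have hne : (ρ : ℂ) ^ p - 1 ≠ 0 := sub_ne_zero.2 h
      rw [tendsto_zero_iff_norm_tendsto_zero]
      set c := (ρ : ℂ) ^ n * ((ρ : ℂ) ^ k - 1)
      have h0 : Tendsto (fun N : ℕ => (N : ℝ)⁻¹ * (‖c‖ * (2 / ‖(ρ : ℂ) ^ p - 1‖))) atTop (𝓝 0) := by
        simpa using (tendsto_inv_atTop_nhds_zero_nat (𝕜 := ℝ)).mul_const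
          (‖c‖ * (2 / ‖(ρ : ℂ) ^ p - 1‖))
      refine squeeze_zero (fun _ => norm_nonneg _) (fun N => ?_) h0
      rw [geom_sum_eq h, norm_mul, norm_mul, norm_div, norm_inv, Complex.norm_natCast]
      gcongr
      refine (norm_sub_le _ _).trans ?_
      simp only [norm_pow, Circle.norm_coe, one_pow, norm_one]
      norm_num
  | zero => simp
  | add f g _ _ hf hg =>
    have := hf.add hg
    rw [add_zero] at this
    refine this.congr fun N => ?_
    rw [← mul_add, ← Finset.sum_add_distrib]
    congr 1
    exact Finset.sum_congr rfl fun i _ => by simp only [Pi.add_apply]; ring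
  | smul c f _ hf =>
    have := hf.const_mul c
    rw [mul_zero] at this
    refine this.congr fun N => ?_
    rw [mul_left_comm, Finset.mul_sum]
    congr 1
    exact Finset.sum_congr rfl fun i _ => by simp only [Pi.smul_apply, smul_eq_mul]; ring

/-- A sequence with values in `{0, 1}` that is close to a trigonometric sequence is periodic, and
every exponent of the torsion of the group of frequencies is a period. -/
lemma periodic_of_near_trigSequences {Γ : Subgroup Circle} {k : ℕ}
    (hk : ∀ ρ ∈ Γ, IsOfFinOrder ρ → ρ ^ k = 1) {a f : ℕ → ℂ} (ha : ∀ n, a n = 0 ∨ a n = 1)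
    (hf : f ∈ trigSequences Γ) (haf : ∀ n, ‖f n - a n‖ < 1 / 4) (n : ℕ) : a (n + k) = a n := by
  have rigid : ∀ m n, ‖a m - a n‖ < 1 → a m = a n := by
    intro m n h
    rcases ha m with h1 | h1 <;> rcases ha n with h2 | h2 <;> rw [h1, h2] at h ⊢ <;> norm_num at h
  obtain ⟨p, hp, hper⟩ : ∃ p : ℕ, 0 < p ∧ ∀ n, ‖f (n + p) - f n‖ < 1 / 4 := by
    obtain ⟨s, hs, hsub⟩ := trigSequences_recurrent hf (1 / 4) (by norm_num)
    have h1 := mapClusterPt_iff_frequently.1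
      (mapClusterPt_one_atTop_pow (fun ρ : Circle => ρ)) s hs
    obtain ⟨p, hps, hp⟩ := (h1.and_eventually (eventually_gt_atTop 0)).exists
    exact ⟨p, hp, hsub hps⟩
  have aper : ∀ n, a (n + p) = a n := by
    intro n
    refine rigid _ _ ?_
    have e : a (n + p) - a n =
        -(f (n + p) - a (n + p)) + (f (n + p) - f n) + (f n - a n) := by ring
    rw [e]
    have h1 := norm_add₃_le (a := -(f (n + p) - a (n + p))) (b := f (n + p) - f n) (c := f n - a n)
    rw [norm_neg] at h1
    linarith [haf n, haf (n + p), hper n]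
  have aper' : ∀ n i, a (n + p * i) = a n := by
    intro n i
    induction i with
    | zero => simp
    | succ i ih => rw [mul_add, mul_one, ← add_assoc, aper, ih]
  refine rigid _ _ ?_
  have hbound : ∀ N : ℕ, 0 < N → ‖(N : ℂ)⁻¹ * ∑ i ∈ Finset.range N,
      (f (n + k + p * i) - f (n + p * i)) - (a (n + k) - a n)‖ ≤ 1 / 2 := by
    intro N hN
    have hN' : (N : ℂ) ≠ 0 := by exact_mod_cast hN.ne'
    have e : (N : ℂ)⁻¹ * ∑ i ∈ Finset.range N,
        (f (n + k + p * i) - f (n + p * i)) - (a (n + k) - a n) =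
        (N : ℂ)⁻¹ * ∑ i ∈ Finset.range N, ((f (n + k + p * i) - a (n + k + p * i)) -
          (f (n + p * i) - a (n + p * i))) := by
      simp only [aper', Finset.sum_sub_distrib, Finset.sum_const, Finset.card_range, nsmul_eq_mul]
      field_simp
      ring
    rw [e, norm_mul, norm_inv, Complex.norm_natCast]
    have h1 : ‖∑ i ∈ Finset.range N, ((f (n + k + p * i) - a (n + k + p * i)) -
          (f (n + p * i) - a (n + p * i)))‖ ≤ ∑ i ∈ Finset.range N, (1 / 2 : ℝ) := by
      refine norm_sum_le_of_le _ fun i _ => (norm_sub_le _ _).trans ?_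
      linarith [haf (n + k + p * i), haf (n + p * i)]
    rw [Finset.sum_const, Finset.card_range, nsmul_eq_mul] at h1
    have hN'' : (0 : ℝ) < N := by exact_mod_cast hN
    rw [inv_mul_le_iff₀ hN'']
    exact h1
  have hlim := ((trigSequences_average hp hk hf n).sub_const (a (n + k) - a n)).norm
  have := le_of_tendsto hlim ((eventually_gt_atTop 0).mono hbound)
  rw [zero_sub, norm_neg] at this
  linarith

/-- Functions on a compact space whose values along an orbit `o` are trigonometric sequences. -/
def trigFunctions {X : Type*} [TopologicalSpace X] (Γ : Subgroup Circle) (o : ℕ → X) :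
    StarSubalgebra ℂ C(X, ℂ) where
  carrier := {f | (fun n => f (o n)) ∈ trigSequences Γ}
  mul_mem' := by
    intro f g hf hg
    have h : ∀ u ∈ trigSequences Γ, ∀ v ∈ trigSequences Γ, u * v ∈ trigSequences Γ := by
      intro u hu v hv
      have h1 := Submodule.mul_mem_mul hu hv
      rw [trigSequences, Submodule.span_mul_span] at h1
      refine Submodule.span_mono ?_ h1
      rintro _ ⟨_, ⟨ρ, hρ, rfl⟩, _, ⟨σ, hσ, rfl⟩, rfl⟩
      exact ⟨ρ * σ, mul_mem hρ hσ, by funext n; simp [mul_pow]⟩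
    exact h _ hf _ hg
  one_mem' := Submodule.subset_span ⟨1, one_mem _, by funext n; simp⟩
  add_mem' hf hg := (trigSequences Γ).add_mem hf hg
  zero_mem' := (trigSequences Γ).zero_mem
  algebraMap_mem' c := by
    have : (fun _ : ℕ => (1 : ℂ)) ∈ trigSequences Γ :=
      Submodule.subset_span ⟨1, one_mem _, by funext n; simp⟩
    have := Submodule.smul_mem _ c this
    have e : (fun n => algebraMap ℂ C(X, ℂ) c (o n)) = c • fun _ => (1 : ℂ) := by
      funext n
      simp
    change (fun n => algebraMap ℂ C(X, ℂ) c (o n)) ∈ trigSequences Γ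
    rwa [e]
  star_mem' := by
    intro f hf
    have h : ∀ u ∈ trigSequences Γ, star u ∈ trigSequences Γ := by
      intro u hu
      induction hu using Submodule.span_induction with
      | mem u hu =>
        obtain ⟨ρ, hρ, rfl⟩ := hu
        refine Submodule.subset_span ⟨ρ⁻¹, inv_mem hρ, ?_⟩
        funext n
        simp [← Circle.coe_inv_eq_conj]
      | zero => simp
      | add u v _ _ hu hv => rw [star_add]; exact Submodule.add_mem _ hu hv
      | smul c u _ hu => rw [star_smul]; exact Submodule.smul_mem _ _ hu
    exact h _ hf

lemma mem_trigFunctions {X : Type*} [TopologicalSpace X] {Γ : Subgroup Circle} {o : ℕ → X}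
    {f : C(X, ℂ)} : f ∈ trigFunctions Γ o ↔ (fun n => f (o n)) ∈ trigSequences Γ := Iff.rfl

/-- If the trigonometric functions along an orbit `o` separate the points of a compact space,
then `o k` lies in the connected component of `o 0`, where `k` is an exponent of the torsion of
the group of frequencies. -/
lemma orbit_mem_connectedComponent {X : Type*} [TopologicalSpace X] [CompactSpace X] [T2Space X]
    {Γ : Subgroup Circle} {k : ℕ} (hk : ∀ ρ ∈ Γ, IsOfFinOrder ρ → ρ ^ k = 1) (o : ℕ → X)
    (hsep : (trigFunctions Γ o).SeparatesPoints) : o k ∈ connectedComponent (o 0) := by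
  classical
  rw [connectedComponent_eq_iInter_isClopen, Set.mem_iInter]
  rintro ⟨s, hs, h0⟩
  let χ : C(X, ℂ) := ⟨s.indicator 1, (continuous_one).indicator
    (by simp [hs.frontier_eq])⟩
  have hχ : χ ∈ closure ((trigFunctions Γ o : StarSubalgebra ℂ C(X, ℂ)) : Set C(X, ℂ)) := by
    have := ContinuousMap.starSubalgebra_topologicalClosure_eq_top_of_separatesPoints _ hsep
    have h2 : χ ∈ (trigFunctions Γ o).topologicalClosure := this ▸ trivial
    exact h2
  obtain ⟨f, hf, hd⟩ := Metric.mem_closure_iff.1 hχ (1 / 4) (by norm_num)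
  have h := periodic_of_near_trigSequences hk (a := fun n => χ (o n)) (f := fun n => f (o n))
    (fun n => ?_)
    (mem_trigFunctions.1 hf) (fun n => ?_) 0
  · by_contra hcon
    have h1 : χ (o 0) = 1 := Set.indicator_of_mem h0 _
    have h2 : χ (o k) = 0 := Set.indicator_of_notMem hcon _
    simp only [zero_add] at h
    rw [h1, h2] at h
    exact zero_ne_one h
  · by_cases hn : o n ∈ s
    · exact Or.inr (Set.indicator_of_mem hn _)
    · exact Or.inl (Set.indicator_of_notMem hn _)
  · rw [← dist_eq_norm, dist_comm]
    exact (ContinuousMap.dist_apply_le_dist _).trans_lt hd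

end AlmostPeriodic

/-! ### Linear dynamics on invariant cones -/

section Dynamics

open Filter Topology

lemma le_of_forall_mul_pow_le {a b s t : ℝ} (ha : 0 < a) (ht : 0 < t)
    (h : ∀ n : ℕ, a * s ^ n ≤ b * t ^ n) : s ≤ t := by
  by_contra! hts
  have h1 : 1 < s / t := (one_lt_div ht).2 hts
  obtain ⟨n, hn⟩ := pow_unbounded_of_one_lt (b / a) h1
  rw [div_pow, div_lt_div_iff₀ ha (pow_pos ht n)] at hn
  linarith [h n, mul_comm (s ^ n) a]

variable {E : Type*} [NormedAddCommGroup E] [NormedSpace ℝ E]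

/-- Precomposition with `L` on the complex-valued linear functionals. -/
noncomputable def precompEnd (L : E →ₗ[ℝ] E) : Module.End ℂ (E →ₗ[ℝ] ℂ) where
  toFun ψ := ψ ∘ₗ L
  map_add' _ _ := rfl
  map_smul' _ _ := rfl

lemma precompEnd_apply (L : E →ₗ[ℝ] E) (ψ : E →ₗ[ℝ] ℂ) (x : E) :
    precompEnd L ψ x = ψ (L x) := rfl

/-- The data of an invariant closed cone that meets no proper invariant subspace. -/
structure IsIrreducibleCone (L : E →ₗ[ℝ] E) (C : Set E) : Prop where
  zero_notMem : (0 : E) ∉ C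
  smul_mem : ∀ c : ℝ, 0 < c → ∀ x ∈ C, c • x ∈ C
  map_mem : ∀ x ∈ C, L x ∈ C
  closed : IsClosed (insert 0 C)
  irreducible : ∀ W : Submodule ℝ E, W ≠ ⊤ → (∀ x ∈ W, L x ∈ W) → ∀ x ∈ W, x ∉ C

namespace IsIrreducibleCone

variable {L : E →ₗ[ℝ] E} {C : Set E}

lemma pow_mem (h : IsIrreducibleCone L C) {x : E} (hx : x ∈ C) (n : ℕ) : (L ^ n) x ∈ C := by
  induction n with
  | zero => simpa
  | succ n ih => rw [pow_succ']; exact h.map_mem _ ih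

/-- An eigenfunctional vanishes nowhere on the cone, since its kernel is invariant. -/
lemma eigen_ne_zero (h : IsIrreducibleCone L C) {ψ : E →ₗ[ℝ] ℂ} {z : ℂ}
    (hψ : precompEnd L ψ = z • ψ) (hne : ψ ≠ 0) {x : E} (hx : x ∈ C) : ψ x ≠ 0 := by
  intro h0
  refine h.irreducible (LinearMap.ker ψ) ?_ ?_ x h0 hx
  · rwa [Ne, LinearMap.ker_eq_top]
  · intro y hy
    rw [LinearMap.mem_ker] at hy ⊢
    rw [← precompEnd_apply, hψ, LinearMap.smul_apply, hy, smul_zero]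

lemma eigen_pow {ψ : E →ₗ[ℝ] ℂ} {z : ℂ} (hψ : precompEnd L ψ = z • ψ) (x : E) (n : ℕ) :
    ψ ((L ^ n) x) = z ^ n * ψ x := by
  induction n with
  | zero => simp
  | succ n ih =>
    rw [pow_succ', Module.End.mul_apply, ← precompEnd_apply, hψ, LinearMap.smul_apply, ih,
      smul_eq_mul]
    ring

lemma eigenvalue_ne_zero (h : IsIrreducibleCone L C) {ψ : E →ₗ[ℝ] ℂ} {z : ℂ}
    (hψ : precompEnd L ψ = z • ψ) (hne : ψ ≠ 0) {x : E} (hx : x ∈ C) : z ≠ 0 := by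
  rintro rfl
  refine h.eigen_ne_zero hψ hne (h.map_mem x hx) ?_
  rw [← precompEnd_apply, hψ, zero_smul, LinearMap.zero_apply]

variable [FiniteDimensional ℝ E]

lemma exists_norm_le (ψ : E →ₗ[ℝ] ℂ) : ∃ M : ℝ, 0 < M ∧ ∀ x, ‖ψ x‖ ≤ M * ‖x‖ := by
  refine ⟨‖LinearMap.toContinuousLinearMap ψ‖ + 1, by positivity, fun x => ?_⟩
  have := (LinearMap.toContinuousLinearMap ψ).le_opNorm x
  have h2 : ‖ψ x‖ ≤ ‖LinearMap.toContinuousLinearMap ψ‖ * ‖x‖ := this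
  nlinarith [norm_nonneg x]

/-- By compactness, an eigenfunctional dominates the norm on the cone. -/
lemma exists_le_norm (h : IsIrreducibleCone L C) {ψ : E →ₗ[ℝ] ℂ} {z : ℂ}
    (hψ : precompEnd L ψ = z • ψ) (hne : ψ ≠ 0) :
    ∃ c : ℝ, 0 < c ∧ ∀ x ∈ C, c * ‖x‖ ≤ ‖ψ x‖ := by
  have : ProperSpace E := FiniteDimensional.proper_real E
  have hK : IsCompact (insert 0 C ∩ Metric.sphere (0 : E) 1) :=
    (isCompact_sphere 0 1).inter_left h.closed
  have hKC : ∀ y ∈ insert 0 C ∩ Metric.sphere (0 : E) 1, y ∈ C := by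
    rintro y ⟨rfl | hy, hy1⟩
    · simp at hy1
    · exact hy
  rcases (insert 0 C ∩ Metric.sphere (0 : E) 1).eq_empty_or_nonempty with he | hne'
  · refine ⟨1, one_pos, fun x hx => ?_⟩
    have hx0 : x ≠ 0 := fun h0 => h.zero_notMem (h0 ▸ hx)
    have : ‖x‖⁻¹ • x ∈ insert 0 C ∩ Metric.sphere (0 : E) 1 :=
      ⟨Or.inr (h.smul_mem _ (by positivity) x hx), by simp [norm_smul, hx0]⟩
    rw [he] at this
    exact this.elim
  · have hcont : Continuous fun x => ‖ψ x‖ := (ψ.continuous_of_finiteDimensional).norm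
    obtain ⟨y, hy, hmin⟩ := hK.exists_isMinOn hne' hcont.continuousOn
    refine ⟨‖ψ y‖, norm_pos_iff.2 (h.eigen_ne_zero hψ hne (hKC y hy)), fun x hx => ?_⟩
    have hx0 : x ≠ 0 := fun h0 => h.zero_notMem (h0 ▸ hx)
    have hx1 : ‖x‖⁻¹ • x ∈ insert 0 C ∩ Metric.sphere (0 : E) 1 :=
      ⟨Or.inr (h.smul_mem _ (by positivity) x hx), by simp [norm_smul, hx0]⟩
    have h2 : ‖ψ y‖ ≤ ‖ψ (‖x‖⁻¹ • x)‖ := hmin hx1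
    rw [map_smul, norm_smul, norm_inv, norm_norm, inv_mul_eq_div,
      le_div_iff₀ (norm_pos_iff.2 hx0)] at h2
    exact h2

/-- The orbit of a point of the cone grows exactly like `‖z‖ ^ n`, for every eigenvalue `z`. -/
lemma exists_growth (h : IsIrreducibleCone L C) {ψ : E →ₗ[ℝ] ℂ} {z : ℂ}
    (hψ : precompEnd L ψ = z • ψ) (hne : ψ ≠ 0) {x : E} (hx : x ∈ C) :
    ∃ a b : ℝ, 0 < a ∧ 0 < b ∧ ∀ n : ℕ, a * ‖z‖ ^ n ≤ ‖(L ^ n) x‖ ∧ ‖(L ^ n) x‖ ≤ b * ‖z‖ ^ n := by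
  obtain ⟨c, hc, hc'⟩ := h.exists_le_norm hψ hne
  obtain ⟨M, hM, hM'⟩ := exists_norm_le ψ
  have hpos : 0 < ‖ψ x‖ := norm_pos_iff.2 (h.eigen_ne_zero hψ hne hx)
  refine ⟨‖ψ x‖ / M, ‖ψ x‖ / c, by positivity, by positivity, fun n => ⟨?_, ?_⟩⟩
  · have := hM' ((L ^ n) x)
    rw [eigen_pow hψ, norm_mul, norm_pow] at this
    rw [div_mul_eq_mul_div, div_le_iff₀ hM]
    linarith
  · have := hc' _ (h.pow_mem hx n)
    rw [eigen_pow hψ, norm_mul, norm_pow] at this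
    rw [div_mul_eq_mul_div, le_div_iff₀ hc]
    linarith

lemma norm_eigenvalue_eq (h : IsIrreducibleCone L C) {ψ ψ' : E →ₗ[ℝ] ℂ} {z z' : ℂ}
    (hψ : precompEnd L ψ = z • ψ) (hne : ψ ≠ 0) (hψ' : precompEnd L ψ' = z' • ψ') (hne' : ψ' ≠ 0)
    {x : E} (hx : x ∈ C) : ‖z‖ = ‖z'‖ := by
  obtain ⟨a, b, ha, hb, hab⟩ := h.exists_growth hψ hne hx
  obtain ⟨a', b', ha', hb', hab'⟩ := h.exists_growth hψ' hne' hx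
  have hz := norm_pos_iff.2 (h.eigenvalue_ne_zero hψ hne hx)
  have hz' := norm_pos_iff.2 (h.eigenvalue_ne_zero hψ' hne' hx)
  exact le_antisymm
    (le_of_forall_mul_pow_le ha hz' fun n => (hab n).1.trans (hab' n).2)
    (le_of_forall_mul_pow_le ha' hz fun n => (hab' n).1.trans (hab n).2)

/-- There are no Jordan blocks: a generalized eigenfunctional would grow like `n * ‖z‖ ^ n` along
an orbit. -/
lemma eigen_of_generalized (h : IsIrreducibleCone L C) {ψ ψ' : E →ₗ[ℝ] ℂ} {z : ℂ}
    (hψ : precompEnd L ψ = z • ψ + ψ') (hψ' : precompEnd L ψ' = z • ψ') {x : E} (hx : x ∈ C) :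
    ψ' = 0 := by
  by_contra hne
  have hz := h.eigenvalue_ne_zero hψ' hne hx
  obtain ⟨a, b, ha, hb, hab⟩ := h.exists_growth hψ' hne hx
  obtain ⟨M, hM, hM'⟩ := exists_norm_le ψ
  have hval : ∀ n : ℕ, ψ ((L ^ n) x) = z ^ n * (ψ x + n * (z⁻¹ * ψ' x)) := by
    intro n
    induction n with
    | zero => simp
    | succ n ih =>
      rw [pow_succ', Module.End.mul_apply, ← precompEnd_apply, hψ, LinearMap.add_apply,
        LinearMap.smul_apply, ih, eigen_pow hψ', smul_eq_mul]
      push_cast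
      field_simp
      ring
  have hpos : 0 < ‖z⁻¹ * ψ' x‖ :=
    norm_pos_iff.2 (mul_ne_zero (inv_ne_zero hz) (h.eigen_ne_zero hψ' hne hx))
  obtain ⟨n, hn⟩ := exists_nat_gt ((M * b + ‖ψ x‖) / ‖z⁻¹ * ψ' x‖)
  rw [div_lt_iff₀ hpos] at hn
  have h1 : ‖z ^ n * (ψ x + n * (z⁻¹ * ψ' x))‖ ≤ M * (b * ‖z‖ ^ n) := by
    rw [← hval]
    exact (hM' _).trans (mul_le_mul_of_nonneg_left (hab n).2 hM.le)
  rw [norm_mul, norm_pow] at h1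
  have hzn : 0 < ‖z‖ ^ n := pow_pos (norm_pos_iff.2 hz) n
  have h2 : ‖ψ x + n * (z⁻¹ * ψ' x)‖ ≤ M * b := by
    refine le_of_mul_le_mul_left ?_ hzn
    linarith
  have h3 : ‖(n : ℂ) * (z⁻¹ * ψ' x)‖ ≤ ‖ψ x + n * (z⁻¹ * ψ' x)‖ + ‖ψ x‖ := by
    have := norm_sub_le (ψ x + n * (z⁻¹ * ψ' x)) (ψ x)
    rwa [add_sub_cancel_left] at this
  rw [norm_mul, Complex.norm_natCast] at h3
  linarith

lemma iSup_eigenspace_eq_top (h : IsIrreducibleCone L C) {x : E} (hx : x ∈ C) :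
    ⨆ z, (precompEnd L).eigenspace z = ⊤ := by
  rw [eq_top_iff, ← Module.End.iSup_maxGenEigenspace_eq_top (precompEnd L)]
  refine iSup_mono fun z ψ hψ => ?_
  rw [Module.End.mem_maxGenEigenspace] at hψ
  obtain ⟨k, hk⟩ := hψ
  rw [Module.End.mem_eigenspace_iff, ← sub_eq_zero]
  have key : ∀ (k : ℕ) (ψ : E →ₗ[ℝ] ℂ), ((precompEnd L - z • 1) ^ k) ψ = 0 →
      (precompEnd L - z • 1) ψ = 0 := by
    intro k
    induction k with
    | zero => intro ψ hψ; simp at hψ; simp [hψ]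
    | succ k ih =>
      intro ψ hψ
      rw [pow_succ, Module.End.mul_apply] at hψ
      have h1 := ih _ hψ
      refine h.eigen_of_generalized (ψ := ψ) (z := z) ?_ ?_ hx
      · simp
      · rwa [LinearMap.sub_apply, sub_eq_zero] at h1
  exact key k ψ hk

/-- Along an orbit of an irreducible cone, the direction of `L ^ k x` lies in the same connected
component as that of `x`, for some `k > 0`. -/
lemma exists_preconnected (h : IsIrreducibleCone L C) {x : E} (hx : x ∈ C) :
    ∃ k : ℕ, 0 < k ∧ ∃ c : ℝ, 0 < c ∧ ∃ Q ⊆ C, IsPreconnected Q ∧ x ∈ Q ∧ c • (L ^ k) x ∈ Q := by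
  have hx0 : x ≠ 0 := fun h0 => h.zero_notMem (h0 ▸ hx)
  have : Nontrivial E := ⟨x, 0, hx0⟩
  have hsepE : ∀ y : E, y ≠ 0 → ∃ ψ : E →ₗ[ℝ] ℂ, ψ y ≠ 0 := by
    intro y hy
    obtain ⟨f, hf⟩ : ∃ f : E →ₗ[ℝ] ℝ, f y ≠ 0 := by
      by_contra! hcon
      exact hy ((Module.forall_dual_apply_eq_zero_iff ℝ y).1 hcon)
    exact ⟨Complex.ofRealCLM.toLinearMap ∘ₗ f, by simpa using hf⟩
  have : Nontrivial (E →ₗ[ℝ] ℂ) := by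
    obtain ⟨ψ, hψ⟩ := hsepE x hx0
    exact ⟨ψ, 0, fun h0 => hψ (by simp [h0])⟩
  obtain ⟨z₀, hz₀⟩ := Module.End.exists_eigenvalue (precompEnd L)
  obtain ⟨ψ₀, hψ₀⟩ := hz₀.exists_hasEigenvector
  have hψ₀' := hψ₀.apply_eq_smul
  have hne₀ := hψ₀.2
  set μ : ℝ := ‖z₀‖
  have hμ : 0 < μ := norm_pos_iff.2 (h.eigenvalue_ne_zero hψ₀' hne₀ hx)
  have hμ' : (μ : ℂ) ≠ 0 := by exact_mod_cast hμ.ne'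
  obtain ⟨a, b, ha, hb, hab⟩ := h.exists_growth hψ₀' hne₀ hx
  -- The frequencies are the eigenvalues, scaled to have modulus one.
  set F : Set Circle := {ρ | (precompEnd L).HasEigenvalue (μ * ρ)}
  have hFfin : F.Finite := by
    have h1 : {z | (precompEnd L).HasEigenvalue z}.Finite :=
      Module.End.finite_hasEigenvalue _
    refine h1.preimage (f := fun ρ : Circle => (μ : ℂ) * ρ) fun ρ _ σ _ e => ?_
    exact Circle.ext (mul_left_cancel₀ hμ' e)
  obtain ⟨k, hk0, hk⟩ := exists_torsion_exponent (Subgroup.closure F)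
    ((Subgroup.fg_iff _).2 ⟨F, rfl, hFfin⟩)
  let y : ℕ → E := fun n => (μ ^ n)⁻¹ • (L ^ n) x
  have hyC : ∀ n, y n ∈ C := fun n => h.smul_mem _ (by positivity) _ (h.pow_mem hx n)
  have hynorm : ∀ n, a ≤ ‖y n‖ ∧ ‖y n‖ ≤ b := by
    intro n
    have hpos : 0 < μ ^ n := pow_pos hμ n
    simp only [y, norm_smul, norm_inv, norm_pow, Real.norm_of_nonneg hμ.le]
    rw [le_inv_mul_iff₀ hpos, inv_mul_le_iff₀ hpos]
    exact ⟨by linarith [(hab n).1], by linarith [(hab n).2]⟩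
  have htrig : ∀ ψ : E →ₗ[ℝ] ℂ, (fun n => ψ (y n)) ∈ trigSequences (Subgroup.closure F) := by
    intro ψ
    have hψ : ψ ∈ ⨆ z, (precompEnd L).eigenspace z := by
      rw [h.iSup_eigenspace_eq_top hx]; trivial
    induction hψ using Submodule.iSup_induction' with
    | mem z ψ hψ =>
      rw [Module.End.mem_eigenspace_iff] at hψ
      by_cases hne : ψ = 0
      · subst hne
        exact (trigSequences _).zero_mem
      have hz : ‖z‖ = μ := h.norm_eigenvalue_eq hψ hne hψ₀' hne₀ hx
      have hcirc : z / μ ∈ Submonoid.unitSphere ℂ := by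
        change z / μ ∈ Metric.sphere (0 : ℂ) 1
        simp [hz, abs_of_pos hμ, hμ.ne']
      let ρ : Circle := ⟨z / μ, hcirc⟩
      have hρ : (μ : ℂ) * ρ = z := by
        change (μ : ℂ) * (z / μ) = z
        field_simp
      have hρF : ρ ∈ F := by
        change (precompEnd L).HasEigenvalue (μ * ρ)
        rw [hρ]
        exact Module.End.hasEigenvalue_of_hasEigenvector
          ⟨Module.End.mem_eigenspace_iff.2 hψ, hne⟩
      have h1 : (fun n : ℕ => (ρ : ℂ) ^ n) ∈ trigSequences (Subgroup.closure F) :=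
        Submodule.subset_span ⟨ρ, Subgroup.subset_closure hρF, rfl⟩
      have h2 : (fun n => ψ (y n)) = ψ x • fun n : ℕ => (ρ : ℂ) ^ n := by
        funext n
        simp only [y, map_smul, eigen_pow hψ, Pi.smul_apply, smul_eq_mul, Complex.real_smul]
        rw [← hρ]
        push_cast
        field_simp
        ring
      rw [h2]
      exact Submodule.smul_mem _ _ h1
    | zero => exact (trigSequences _).zero_mem
    | add ψ ψ' _ _ h1 h2 => exact Submodule.add_mem _ h1 h2
  have : ProperSpace E := FiniteDimensional.proper_real E
  let K : Set E := closure (Set.range y)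
  have hKcomp : IsCompact K := by
    refine Metric.isCompact_of_isClosed_isBounded isClosed_closure (Bornology.IsBounded.closure ?_)
    refine (Metric.isBounded_closedBall (x := (0 : E)) (r := b)).subset ?_
    rintro _ ⟨n, rfl⟩
    simpa using (hynorm n).2
  have hKC : K ⊆ C := by
    have h1 : K ⊆ insert 0 C :=
      closure_minimal (by rintro _ ⟨n, rfl⟩; exact Or.inr (hyC n)) h.closed
    have h2 : K ⊆ {v | a ≤ ‖v‖} :=
      closure_minimal (by rintro _ ⟨n, rfl⟩; exact (hynorm n).1)
        (isClosed_le continuous_const continuous_norm)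
    intro v hv
    rcases h1 hv with rfl | h3
    · have : a ≤ ‖(0 : E)‖ := h2 hv
      rw [norm_zero] at this
      linarith
    · exact h3
  have : CompactSpace K := isCompact_iff_compactSpace.1 hKcomp
  let o : ℕ → K := fun n => ⟨y n, subset_closure ⟨n, rfl⟩⟩
  have hconn := orbit_mem_connectedComponent hk o (by
    intro u v huv
    obtain ⟨ψ, hψ⟩ := hsepE ((u : E) - v) (sub_ne_zero.2 fun e => huv (Subtype.ext e))
    rw [map_sub, sub_ne_zero] at hψ
    let f : C(K, ℂ) :=
      ⟨fun w => ψ w, ψ.continuous_of_finiteDimensional.comp continuous_subtype_val⟩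
    exact ⟨f, ⟨f, htrig ψ, rfl⟩, hψ⟩)
  refine ⟨k, hk0, (μ ^ k)⁻¹, by positivity, Subtype.val '' connectedComponent (o 0), ?_, ?_, ?_, ?_⟩
  · rintro _ ⟨w, -, rfl⟩
    exact hKC w.2
  · exact isPreconnected_connectedComponent.image _ continuous_subtype_val.continuousOn
  · exact ⟨o 0, mem_connectedComponent, by simp [o, y]⟩
  · exact ⟨o k, hconn, rfl⟩

end IsIrreducibleCone

/-- A linear map that preserves a nonempty closed cone `C` maps some point of `C`, after finitely
many iterations and up to scaling, into the connected component of that point in `C`. -/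
theorem exists_preconnected_of_invariant_cone {E : Type*} [NormedAddCommGroup E] [NormedSpace ℝ E]
    [FiniteDimensional ℝ E] (L : E →ₗ[ℝ] E) (C : Set E) (hne : C.Nonempty) (h0 : (0 : E) ∉ C)
    (hsmul : ∀ c : ℝ, 0 < c → ∀ x ∈ C, c • x ∈ C) (hmap : ∀ x ∈ C, L x ∈ C)
    (hclosed : IsClosed (insert 0 C)) :
    ∃ x ∈ C, ∃ k : ℕ, 0 < k ∧ ∃ c : ℝ, 0 < c ∧
      ∃ Q ⊆ C, IsPreconnected Q ∧ x ∈ Q ∧ c • (L ^ k) x ∈ Q := by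
  induction hd : Module.finrank ℝ E using Nat.strong_induction_on generalizing E with
  | _ d ih =>
    by_cases hirr : ∀ W : Submodule ℝ E, W ≠ ⊤ → (∀ x ∈ W, L x ∈ W) → ∀ x ∈ W, x ∉ C
    · obtain ⟨x, hx⟩ := hne
      exact ⟨x, hx, IsIrreducibleCone.exists_preconnected ⟨h0, hsmul, hmap, hclosed, hirr⟩ hx⟩
    · push Not at hirr
      obtain ⟨W, hW, hLW, w, hwW, hwC⟩ := hirr
      have hpow : ∀ (n : ℕ) (v : W), (((L.restrict hLW) ^ n) v : E) = (L ^ n) (v : E) := by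
        intro n v
        induction n with
        | zero => simp
        | succ n ih => rw [pow_succ', pow_succ', Module.End.mul_apply, Module.End.mul_apply,
            LinearMap.coe_restrict_apply, ih]
      obtain ⟨x, hx, k, hk, c, hc, Q, hQ, hQp, hxQ, hcQ⟩ := ih (Module.finrank ℝ W)
        (hd ▸ Submodule.finrank_lt hW) (L.restrict hLW) (Subtype.val ⁻¹' C) ⟨⟨w, hwW⟩, hwC⟩
        h0 (fun c hc x hx => hsmul c hc x hx) (fun x hx => hmap x hx)
        (by
          have h1 := hclosed.preimage (continuous_subtype_val (p := fun x => x ∈ W))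
          have h2 : (insert 0 (Subtype.val ⁻¹' C) : Set W) = Subtype.val ⁻¹' (insert 0 C) := by
            ext v; simp
          rw [h2]; exact h1) rfl
      refine ⟨x, hx, k, hk, c, hc, Subtype.val '' Q, ?_, ?_, ⟨x, hxQ, rfl⟩, ⟨_, hcQ, ?_⟩⟩
      · rintro _ ⟨v, hv, rfl⟩; exact hQ hv
      · exact hQp.image _ continuous_subtype_val.continuousOn
      · rw [Submodule.coe_smul, hpow]

end Dynamics

/-! ### The space of real characters and the character sphere -/

section Characters

open Topology

variable {G : Type*} [Group G]

/-- Evaluation of characters, as a linear map into the functions on the group. -/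
def RealCharacter.evalLinear (G : Type*) [Group G] : RealCharacter G →ₗ[ℝ] G → ℝ where
  toFun χ g := χ (Additive.ofMul g)
  map_add' _ _ := rfl
  map_smul' _ _ := rfl

lemma RealCharacter.evalLinear_injective : Function.Injective (RealCharacter.evalLinear G) :=
  fun _ _ h => DFunLike.ext _ _ fun g => congrFun h g.toMul

instance RealCharacter.instIsTopologicalAddGroup : IsTopologicalAddGroup (RealCharacter G) :=
  topologicalAddGroup_induced (RealCharacter.evalLinear G)

instance RealCharacter.instContinuousSMul : ContinuousSMul ℝ (RealCharacter G) :=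
  continuousSMul_induced (RealCharacter.evalLinear G)

instance RealCharacter.instT2Space : T2Space (RealCharacter G) :=
  T2Space.of_injective_continuous RealCharacter.evalLinear_injective continuous_induced_dom

lemma RealCharacter.finiteDimensional [hG : Group.FG G] :
    FiniteDimensional ℝ (RealCharacter G) := by
  obtain ⟨S, hS⟩ := Group.fg_def.1 hG
  let ev : RealCharacter G →ₗ[ℝ] S → ℝ :=
    (LinearMap.funLeft ℝ ℝ (Subtype.val : S → G)) ∘ₗ RealCharacter.evalLinear G
  refine FiniteDimensional.of_injective ev ?_
  rw [← LinearMap.ker_eq_bot, LinearMap.ker_eq_bot']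
  intro χ hχ
  refine DFunLike.ext _ _ fun x => ?_
  have hx : x.toMul ∈ Subgroup.closure (S : Set G) := hS ▸ Subgroup.mem_top _
  change χ (Additive.ofMul x.toMul) = 0
  generalize x.toMul = g at hx
  induction hx using Subgroup.closure_induction with
  | mem s hs => exact congrFun hχ ⟨s, hs⟩
  | one => simp
  | mul a b _ _ ha hb => simp [ha, hb]
  | inv a _ ha => simp [ha]

/-- The nonzero characters whose class lies in the complement of `Σ¹(G)`. -/
def sigmaComplCone (G : Type*) [Group G] : Set (RealCharacter G) := {χ | χ ≠ 0 ∧ ¬ χ.IsSigma}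

lemma isClosed_insert_sigmaComplCone : IsClosed (insert 0 (sigmaComplCone G)) := by
  rw [← isOpen_compl_iff, isOpen_iff_mem_nhds]
  intro χ hχ
  have h0 : χ ≠ 0 := fun h => hχ (Or.inl h)
  have h1 : χ.IsSigma := by
    by_contra h; exact hχ (Or.inr ⟨h0, h⟩)
  filter_upwards [h1.eventually h0, isOpen_ne.mem_nhds h0] with χ' h2 h3
  rintro (h | h)
  · exact h3 h
  · exact h.2 h2

/-- A preconnected set of nonzero characters in the complement of `Σ¹(G)` lies over a single
component. -/
lemma mem_connectedComponentIn_of_isPreconnected {Q : Set (RealCharacter G)}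
    (hQ : Q ⊆ sigmaComplCone G) (hc : IsPreconnected Q) {χ χ' : RealCharacter G} (hχ : χ ∈ Q)
    (hχ' : χ' ∈ Q) : rayOfNeZero ℝ χ' (hQ hχ').1 ∈
      connectedComponentIn (sigmaOne G)ᶜ (rayOfNeZero ℝ χ (hQ hχ).1) := by
  let Q' : Set {χ : RealCharacter G // χ ≠ 0} := Subtype.val ⁻¹' Q
  have hQ' : IsPreconnected Q' := by
    have hind : IsInducing (Subtype.val : {χ : RealCharacter G // χ ≠ 0} → RealCharacter G) := ⟨rfl⟩
    rw [← hind.isPreconnected_image, Set.image_preimage_eq_of_subset]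
    · exact hc
    · intro q hq
      exact ⟨⟨q, (hQ hq).1⟩, rfl⟩
  let π : {χ : RealCharacter G // χ ≠ 0} → CharacterSphere G := fun χ => rayOfNeZero ℝ χ.1 χ.2
  have hπ : Continuous π := continuous_coinduced_rng
  refine (hQ'.image π hπ.continuousOn).subset_connectedComponentIn ?_ ?_ ?_
  · exact ⟨⟨χ, (hQ hχ).1⟩, hχ, rfl⟩
  · rintro _ ⟨q, hq, rfl⟩
    rw [Set.mem_compl_iff, rayOfNeZero_mem_sigmaOne]
    exact (hQ hq).2
  · exact ⟨⟨χ', (hQ hχ').1⟩, hχ', rfl⟩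

lemma CharacterSphere.continuous_map (e : RealCharacter G ≃ₗ[ℝ] RealCharacter G)
    (he : Continuous e) : Continuous (Module.Ray.map e : CharacterSphere G → CharacterSphere G) := by
  refine continuous_coinduced_dom.2 ?_
  have : Continuous fun χ : {χ : RealCharacter G // χ ≠ 0} =>
      (⟨e χ.1, e.map_ne_zero_iff.2 χ.2⟩ : {χ : RealCharacter G // χ ≠ 0}) :=
    Continuous.subtype_mk (he.comp continuous_subtype_val) _
  exact (continuous_coinduced_rng (f := fun χ : {χ : RealCharacter G // χ ≠ 0} =>
    rayOfNeZero ℝ χ.1 χ.2)).comp this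

/-- The homeomorphism of the character sphere induced by a linear automorphism. -/
def CharacterSphere.homeomorph [Group.FG G] (e : RealCharacter G ≃ₗ[ℝ] RealCharacter G) :
    CharacterSphere G ≃ₜ CharacterSphere G where
  toEquiv := Module.Ray.map e
  continuous_toFun :=
    have := RealCharacter.finiteDimensional (G := G)
    CharacterSphere.continuous_map e (LinearMap.continuous_of_finiteDimensional e.toLinearMap)
  continuous_invFun :=
    have := RealCharacter.finiteDimensional (G := G)
    CharacterSphere.continuous_map e.symm
      (LinearMap.continuous_of_finiteDimensional e.symm.toLinearMap)

lemma mem_openHemisphere_iff {χ : RealCharacter G} (hχ : χ ≠ 0) (g : G) :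
    rayOfNeZero ℝ χ hχ ∈ openHemisphere g ↔ 0 < χ (Additive.ofMul g) := by
  constructor
  · rintro ⟨χ', hχ', e, h⟩
    rw [ray_eq_iff, exists_pos_left_iff_sameRay hχ' hχ |>.symm] at e
    obtain ⟨c, hc, rfl⟩ := e
    exact mul_pos hc h
  · exact fun h => ⟨χ, hχ, rfl, h⟩

/-- A linear automorphism that preserves `Σ¹(G)` has a power that maps some component of the
complement of `Σ¹(G)` to itself. -/
theorem exists_invariant_component [Group.FG G] (L : RealCharacter G ≃ₗ[ℝ] RealCharacter G)
    (hL : ∀ χ, χ ≠ 0 → ((L χ).IsSigma ↔ χ.IsSigma)) (hne : ((sigmaOne G)ᶜ).Nonempty) :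
    ∃ ξ ∈ (sigmaOne G)ᶜ, ∃ k : ℕ, 0 < k ∧
      Module.Ray.map (L ^ k) '' connectedComponentIn (sigmaOne G)ᶜ ξ =
        connectedComponentIn (sigmaOne G)ᶜ ξ := by
  have hfd := RealCharacter.finiteDimensional (G := G)
  let d := Module.finrank ℝ (RealCharacter G)
  let ε : RealCharacter G ≃L[ℝ] (Fin d → ℝ) :=
    (LinearEquiv.ofFinrankEq (RealCharacter G) (Fin d → ℝ) (by simp [d])).toContinuousLinearEquiv
  let M : (Fin d → ℝ) →ₗ[ℝ] (Fin d → ℝ) := ε.toLinearMap ∘ₗ L.toLinearMap ∘ₗ ε.symm.toLinearMap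
  have hM : ∀ (n : ℕ) v, ε.symm ((M ^ n) v) = (L ^ n) (ε.symm v) := by
    intro n v
    induction n with
    | zero => simp
    | succ n ih =>
      rw [pow_succ', pow_succ', Module.End.mul_apply, LinearEquiv.mul_apply, ← ih]
      simp [M]
  have hcone : ∀ χ ∈ sigmaComplCone G, L χ ∈ sigmaComplCone G := fun χ h =>
    ⟨L.map_ne_zero_iff.2 h.1, fun h' => h.2 ((hL χ h.1).1 h')⟩
  obtain ⟨x, hx, k, hk, c, hc, Q, hQ, hQp, hxQ, hcQ⟩ :=
    exists_preconnected_of_invariant_cone M (ε.symm ⁻¹' sigmaComplCone G)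
      (by
        obtain ⟨ξ, hξ⟩ := hne
        induction ξ using Module.Ray.ind with
        | h χ hχ =>
          rw [Set.mem_compl_iff, rayOfNeZero_mem_sigmaOne] at hξ
          refine ⟨ε χ, ?_⟩
          rw [Set.mem_preimage, ε.symm_apply_apply]
          exact ⟨hχ, hξ⟩)
      (fun h => h.1 (map_zero _))
      (by
        intro c hc x hx
        rw [Set.mem_preimage, map_smul]
        refine ⟨smul_ne_zero hc.ne' hx.1, fun h => hx.2 ?_⟩
        have := h.smul (inv_pos.2 hc)
        rwa [inv_smul_smul₀ hc.ne'] at this)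
      (by
        intro x hx
        have := hM 1 x
        rw [pow_one, pow_one] at this
        rw [Set.mem_preimage, this]
        exact hcone _ hx)
      (by
        have h1 := (isClosed_insert_sigmaComplCone (G := G)).preimage ε.symm.continuous
        have h2 : insert 0 (ε.symm ⁻¹' sigmaComplCone G) =
            ε.symm ⁻¹' (insert 0 (sigmaComplCone G)) := by
          ext v; simp
        rw [h2]; exact h1)
  have hQ' : ε.symm '' Q ⊆ sigmaComplCone G := by
    rintro _ ⟨q, hq, rfl⟩; exact hQ hq
  have hmem := mem_connectedComponentIn_of_isPreconnected hQ'
    (hQp.image _ ε.symm.continuous.continuousOn) ⟨x, hxQ, rfl⟩ ⟨_, hcQ, rfl⟩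
  set χ := ε.symm x with hχdef
  set ξ : CharacterSphere G := rayOfNeZero ℝ χ hx.1 with hξ
  have hξS : ξ ∈ (sigmaOne G)ᶜ := by
    rw [Set.mem_compl_iff, rayOfNeZero_mem_sigmaOne]; exact hx.2
  refine ⟨ξ, hξS, k, hk, ?_⟩
  have hmap : (CharacterSphere.homeomorph (L ^ k)) ξ ∈ connectedComponentIn (sigmaOne G)ᶜ ξ := by
    convert hmem using 1
    change Module.Ray.map (L ^ k) ξ = _
    rw [hξ, Module.Ray.map_apply, ray_eq_iff, map_smul, hM]
    exact SameRay.sameRay_pos_smul_right _ hc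
  have hpow : ∀ n : ℕ, ∀ χ, χ ≠ 0 → ((L ^ n) χ ≠ 0 ∧ (((L ^ n) χ).IsSigma ↔ χ.IsSigma)) := by
    intro n
    induction n with
    | zero => intro χ h; simpa using h
    | succ n ih =>
      intro χ h
      rw [pow_succ', LinearEquiv.mul_apply]
      exact ⟨L.map_ne_zero_iff.2 (ih χ h).1, (hL _ (ih χ h).1).trans (ih χ h).2⟩
  have himg : (CharacterSphere.homeomorph (L ^ k)) '' (sigmaOne G)ᶜ = (sigmaOne G)ᶜ := by
    have hpre : (CharacterSphere.homeomorph (L ^ k)) ⁻¹' (sigmaOne G)ᶜ = (sigmaOne G)ᶜ := by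
      ext η
      induction η using Module.Ray.ind with
      | h θ hθ =>
        change Module.Ray.map (L ^ k) (rayOfNeZero ℝ θ hθ) ∈ (sigmaOne G)ᶜ ↔ _
        rw [Module.Ray.map_apply, Set.mem_compl_iff, Set.mem_compl_iff, rayOfNeZero_mem_sigmaOne,
          rayOfNeZero_mem_sigmaOne, (hpow k θ hθ).2]
    conv_lhs => rw [← hpre]
    exact Set.image_preimage_eq _ (CharacterSphere.homeomorph (L ^ k)).surjective
  have := (CharacterSphere.homeomorph (L ^ k)).image_connectedComponentIn hξS
  rw [himg, ← connectedComponentIn_eq hmap] at this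
  exact this

end Characters

/-! ### Automorphisms of spherical polytopes -/

section Polytope

variable {V : Type*} [AddCommGroup V] [Module ℝ V] {m : ℕ} {v : Fin m → V}
  {P : Set (Module.Ray ℝ V)}

namespace IsSphericalPolytope

lemma vertex_ne_zero (h : IsSphericalPolytope v P) (i : Fin m) : v i ≠ 0 := by
  obtain ⟨f, hf⟩ := h.halfSpace
  intro h0
  have := hf i
  rw [h0, map_zero] at this
  exact lt_irrefl _ this

lemma vertex_mem (h : IsSphericalPolytope v P) (i : Fin m) :
    rayOfNeZero ℝ (v i) (h.vertex_ne_zero i) ∈ P := by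
  classical
  refine (Set.ext_iff.1 h.eq_cone _).2 ⟨v i, h.vertex_ne_zero i, rfl, Pi.single i 1, fun j => ?_, ?_⟩
  · by_cases hj : j = i
    · subst hj; simp
    · simp [hj]
  · simp [Pi.single_apply]

lemma exists_combination (h : IsSphericalPolytope v P) {w : V} (hw : w ≠ 0)
    (hP : rayOfNeZero ℝ w hw ∈ P) : ∃ a : Fin m → ℝ, (∀ i, 0 ≤ a i) ∧ w = ∑ i, a i • v i := by
  rw [h.eq_cone] at hP
  obtain ⟨w', hw', e, a, ha, rfl⟩ := hP
  rw [ray_eq_iff, exists_pos_left_iff_sameRay hw' hw |>.symm] at e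
  obtain ⟨c, hc, rfl⟩ := e
  refine ⟨fun i => c * a i, fun i => mul_nonneg hc.le (ha i), ?_⟩
  rw [Finset.smul_sum]
  exact Finset.sum_congr rfl fun i _ => smul_smul _ _ _

/-- The vertices span extreme rays. -/
lemma eq_zero_of_vertex_eq (h : IsSphericalPolytope v P) {i : Fin m} {c : Fin m → ℝ}
    (hc : ∀ l, 0 ≤ c l) (e : v i = ∑ l, c l • v l) {l : Fin m} (hl : l ≠ i) : c l = 0 := by
  classical
  obtain ⟨f, hf⟩ := h.halfSpace
  rw [← Finset.add_sum_erase _ _ (Finset.mem_univ i)] at e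
  have e' : (1 - c i) • v i = ∑ l ∈ Finset.univ.erase i, c l • v l := by
    rw [sub_smul, one_smul, sub_eq_iff_eq_add']
    exact e
  rcases lt_or_ge (c i) 1 with h1 | h1
  · exfalso
    have h1' : 0 < 1 - c i := by linarith
    refine h.minimal i ⟨fun l => if l = i then 0 else (1 - c i)⁻¹ * c l, fun j => ?_, by simp, ?_⟩
    · dsimp only
      split_ifs
      · exact le_rfl
      · exact mul_nonneg (inv_nonneg.2 h1'.le) (hc j)
    · rw [← Finset.add_sum_erase _ _ (Finset.mem_univ i)]
      dsimp only
      rw [if_pos rfl, zero_smul, zero_add, eq_inv_smul_iff₀ h1'.ne' |>.2 e', Finset.smul_sum]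
      refine Finset.sum_congr rfl fun l hl => ?_
      rw [if_neg (Finset.ne_of_mem_erase hl), smul_smul]
  · have h2 := congrArg f e'
    rw [map_smul, map_sum, smul_eq_mul] at h2
    have h3 : ∀ l ∈ Finset.univ.erase i, 0 ≤ f (c l • v l) := fun l _ => by
      rw [map_smul, smul_eq_mul]
      exact mul_nonneg (hc l) (hf l).le
    have h4 : ∑ l ∈ Finset.univ.erase i, f (c l • v l) = 0 :=
      le_antisymm (h2 ▸ mul_nonpos_of_nonpos_of_nonneg (by linarith) (hf i).le)
        (Finset.sum_nonneg h3)
    have h5 := (Finset.sum_eq_zero_iff_of_nonneg h3).1 h4 l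
      (Finset.mem_erase.2 ⟨hl, Finset.mem_univ l⟩)
    rw [map_smul, smul_eq_mul] at h5
    exact (mul_eq_zero.1 h5).resolve_right (hf l).ne'

/-- A linear automorphism that preserves a polytope permutes the rays of its vertices. -/
lemma exists_map_vertex (h : IsSphericalPolytope v P) (e : V ≃ₗ[ℝ] V)
    (he : Module.Ray.map e '' P = P) (i : Fin m) :
    ∃ (j : Fin m) (c : ℝ), 0 < c ∧ e (v i) = c • v j := by
  have h1 : rayOfNeZero ℝ (e (v i)) (e.map_ne_zero_iff.2 (h.vertex_ne_zero i)) ∈ P := by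
    exact (Set.ext_iff.1 he _).1 ⟨_, h.vertex_mem i, Module.Ray.map_apply e _ _⟩
  obtain ⟨a, ha, hea⟩ := h.exists_combination _ h1
  have h2 : ∀ j, ∃ b : Fin m → ℝ, (∀ l, 0 ≤ b l) ∧ e.symm (v j) = ∑ l, b l • v l := by
    intro j
    refine h.exists_combination (e.symm.map_ne_zero_iff.2 (h.vertex_ne_zero j)) ?_
    have h3 := (Set.ext_iff.1 he _).2 (h.vertex_mem j)
    obtain ⟨η, hη, hηj⟩ := h3
    have h4 : η = rayOfNeZero ℝ (e.symm (v j))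
        (e.symm.map_ne_zero_iff.2 (h.vertex_ne_zero j)) := by
      apply (Module.Ray.map e).injective
      rw [hηj, Module.Ray.map_apply]
      simp
    rwa [← h4]
  choose b hb hbe using h2
  obtain ⟨j, hj⟩ : ∃ j, 0 < a j := by
    by_contra! hcon
    have : e (v i) = 0 := by
      rw [hea]
      exact Finset.sum_eq_zero fun j _ => by rw [le_antisymm (hcon j) (ha j), zero_smul]
    exact h.vertex_ne_zero i (e.map_eq_zero_iff.1 this)
  -- Pulling the combination back through `e` writes `v i` as a combination of the vertices.
  have hvi : v i = ∑ l, (∑ j, a j * b j l) • v l := by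
    calc v i = e.symm (e (v i)) := (e.symm_apply_apply _).symm
      _ = ∑ j, a j • ∑ l, b j l • v l := by
        rw [hea, map_sum]
        exact Finset.sum_congr rfl fun j _ => by rw [map_smul, hbe]
      _ = _ := by
        simp only [Finset.smul_sum, smul_smul, Finset.sum_smul]
        exact Finset.sum_comm
  have hzero : ∀ l, l ≠ i → b j l = 0 := by
    intro l hl
    have h5 := h.eq_zero_of_vertex_eq
      (fun l => Finset.sum_nonneg fun j _ => mul_nonneg (ha j) (hb j l)) hvi hl
    have h6 := (Finset.sum_eq_zero_iff_of_nonneg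
      (fun j _ => mul_nonneg (ha j) (hb j l))).1 h5 j (Finset.mem_univ j)
    exact (mul_eq_zero.1 h6).resolve_left hj.ne'
  have h7 : e.symm (v j) = b j i • v i := by
    rw [hbe, Finset.sum_eq_single i (fun l _ hl => by rw [hzero l hl, zero_smul]) (by simp)]
  have h8 : b j i ≠ 0 := by
    intro h0
    rw [h0, zero_smul] at h7
    exact h.vertex_ne_zero j (e.symm.map_eq_zero_iff.1 h7)
  refine ⟨j, (b j i)⁻¹, inv_pos.2 (lt_of_le_of_ne (hb j i) h8.symm), ?_⟩
  rw [eq_inv_smul_iff₀ h8, ← map_smul, ← h7, e.apply_symm_apply]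

/-- Some vertex of an invariant polytope is an eigenvector of a power. -/
lemma exists_eigen_vertex (h : IsSphericalPolytope v P) (e : V ≃ₗ[ℝ] V)
    (he : Module.Ray.map e '' P = P) (hP : P.Nonempty) :
    ∃ (j : Fin m) (n : ℕ) (c : ℝ), 0 < n ∧ 0 < c ∧ (e ^ n) (v j) = c • v j := by
  choose π c hc hπ using h.exists_map_vertex e he
  have hiter : ∀ (n : ℕ) (i : Fin m), ∃ c : ℝ, 0 < c ∧ (e ^ n) (v i) = c • v (π^[n] i) := by
    intro n i
    induction n with
    | zero => exact ⟨1, one_pos, by simp⟩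
    | succ n ih =>
      obtain ⟨d, hd, hd'⟩ := ih
      refine ⟨d * c (π^[n] i), mul_pos hd (hc _), ?_⟩
      rw [pow_succ', LinearEquiv.mul_apply, hd', map_smul, hπ, smul_smul,
        Function.iterate_succ_apply']
  obtain ⟨i⟩ : Nonempty (Fin m) := by
    by_contra hcon
    rw [not_nonempty_iff] at hcon
    obtain ⟨ξ, hξ⟩ := hP
    rw [h.eq_cone] at hξ
    obtain ⟨w, hw, -, a, -, hwa⟩ := hξ
    exact hw (by rw [hwa, Finset.univ_eq_empty, Finset.sum_empty])
  obtain ⟨a, b, hab, heq⟩ := Finite.exists_ne_map_eq_of_infinite fun n : ℕ => π^[n] i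
  wlog hlt : a < b generalizing a b
  · exact this b a hab.symm heq.symm (lt_of_le_of_ne (not_lt.1 hlt) hab.symm)
  obtain ⟨d, hd, hd'⟩ := hiter (b - a) (π^[a] i)
  refine ⟨π^[a] i, b - a, d, Nat.sub_pos_of_lt hlt, hd, ?_⟩
  rw [hd', ← Function.iterate_add_apply, Nat.sub_add_cancel hlt.le]
  exact congrArg (fun j => d • v j) heq.symm

end IsSphericalPolytope

end Polytope

/-! ### Restriction of characters and the first Betti number -/

section Betti

variable {G H : Type*} [Group G] [Group H]

/-- Precomposition of characters with a homomorphism, as a linear map. -/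
def RealCharacter.comap (f : G →* H) : RealCharacter H →ₗ[ℝ] RealCharacter G where
  toFun χ := χ.comp f.toAdditive
  map_add' _ _ := rfl
  map_smul' _ _ := rfl

/-- The linear isomorphism of character spaces induced by an isomorphism of groups. -/
def RealCharacter.comapEquiv (e : G ≃* H) : RealCharacter H ≃ₗ[ℝ] RealCharacter G :=
  LinearEquiv.ofLinearMap (RealCharacter.comap e.toMonoidHom)
    (RealCharacter.comap e.symm.toMonoidHom)
    (LinearMap.ext fun χ => DFunLike.ext _ _ fun g =>
      congrArg χ (congrArg Additive.ofMul (e.symm_apply_apply g.toMul)))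
    (LinearMap.ext fun χ => DFunLike.ext _ _ fun h =>
      congrArg χ (congrArg Additive.ofMul (e.apply_symm_apply h.toMul)))

lemma RealCharacter.isSigma_comapEquiv_iff (e : G ≃* H) (χ : RealCharacter H) :
    (RealCharacter.comapEquiv e χ).IsSigma ↔ χ.IsSigma := by
  refine ⟨fun h => ?_, fun h => h.comp_mulEquiv e⟩
  have h1 := h.comp_mulEquiv e.symm
  have h2 : AddMonoidHom.comp (RealCharacter.comapEquiv e χ) e.symm.toMonoidHom.toAdditive = χ :=
    (RealCharacter.comapEquiv e).symm_apply_apply χ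
  rwa [h2] at h1

lemma finrank_realCharacter [Group.FG G] :
    Module.finrank ℝ (RealCharacter G) = firstBetti G := by
  let A := Additive (Abelianization G)
  have hfgA : Group.FG (Abelianization G) :=
    Group.fg_of_surjective (f := Abelianization.of) (QuotientGroup.mk_surjective)
  have hfinA : Module.Finite ℤ A :=
    Module.Finite.iff_addGroup_fg.2 (GroupFG.iff_add_fg.1 hfgA)
  let T := Submodule.torsion ℤ A
  have e₁ : (A →+ ℝ) ≃ₗ[ℝ] RealCharacter G := by
    refine LinearEquiv.ofBijective (RealCharacter.comap (Abelianization.of (G := G))) ⟨?_, ?_⟩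
    · intro χ χ' h
      refine DFunLike.ext _ _ fun a => ?_
      obtain ⟨g, hg⟩ := QuotientGroup.mk_surjective (Additive.toMul a)
      have := DFunLike.congr_fun h (Additive.ofMul g)
      have ha : a = Additive.ofMul (Abelianization.of g) := congrArg Additive.ofMul hg.symm
      rw [ha]
      exact this
    · intro χ
      refine ⟨AddMonoidHom.toMultiplicativeRight.symm
        (Abelianization.lift (AddMonoidHom.toMultiplicativeRight χ)), ?_⟩
      refine DFunLike.ext _ _ fun g => ?_
      rfl
  have e₂ : ((A ⧸ T) →ₗ[ℤ] ℝ) ≃ₗ[ℝ] (A →ₗ[ℤ] ℝ) := by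
    refine LinearEquiv.ofBijective (LinearMap.lcomp ℝ ℝ T.mkQ) ⟨?_, ?_⟩
    · intro f f' h
      refine LinearMap.ext fun a => ?_
      obtain ⟨a, rfl⟩ := T.mkQ_surjective a
      exact LinearMap.congr_fun h a
    · intro f
      refine ⟨T.liftQ f fun a ha => ?_, LinearMap.ext fun _ => rfl⟩
      obtain ⟨n, hn⟩ := (Submodule.mem_torsion_iff a).1 ha
      have h1 : (n : ℤ) • f a = 0 := by
        rw [← map_smul, ← map_zero f]
        exact congrArg f hn
      rw [LinearMap.mem_ker]
      exact (smul_eq_zero.1 h1).resolve_left (nonZeroDivisors.ne_zero n.2)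
  have hfree : Module.Free ℤ (A ⧸ T) := inferInstance
  rw [← (e₂.trans ((addMonoidHomLequivInt ℝ).symm.trans e₁)).finrank_eq,
    Module.finrank_linearMap_self]
  exact congrArg Cardinal.toNat (rank_quotient_eq_of_le_torsion le_rfl)

lemma RealCharacter.comap_subtype_injective (K : Subgroup G) [K.FiniteIndex] :
    Function.Injective (RealCharacter.comap K.subtype) := by
  rw [← LinearMap.ker_eq_bot, LinearMap.ker_eq_bot']
  intro χ hχ
  by_contra hne
  obtain ⟨h, hh, hneg⟩ := RealCharacter.exists_mem_neg K hne
  have : χ (Additive.ofMul h) = 0 := DFunLike.congr_fun hχ (Additive.ofMul ⟨h, hh⟩)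
  linarith

/-- If `b₁(K) = b₁(G)` then restriction to the subgroup `K` of finite index is an isomorphism of
character spaces. -/
noncomputable def RealCharacter.restrictEquiv [Group.FG G] (K : Subgroup G) [K.FiniteIndex]
    (hb : firstBetti K = firstBetti G) : RealCharacter G ≃ₗ[ℝ] RealCharacter K :=
  have := Subgroup.fg_of_index_ne_zero K
  have := RealCharacter.finiteDimensional (G := G)
  have := RealCharacter.finiteDimensional (G := K)
  LinearMap.linearEquivOfInjective (RealCharacter.comap K.subtype)
    (RealCharacter.comap_subtype_injective K)
    (by rw [finrank_realCharacter, finrank_realCharacter, hb])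

end Betti

/-! ### Invariant characters -/

section Invariant

variable {G : Type*} [Group G]

/-- A factor by which an automorphism scales a nonzero character of a finitely generated group
is an algebraic integer, since it preserves the image, a finitely generated group. -/
lemma isIntegral_of_scaling [Group.FG G] {χ : RealCharacter G} (hχ : χ ≠ 0) (φ : G → G) {c : ℝ}
    (h : ∀ g, χ (Additive.ofMul (φ g)) = c * χ (Additive.ofMul g)) : IsIntegral ℤ c := by
  refine isIntegral_of_smul_mem_submodule (M := ℝ) (AddSubgroup.toIntSubmodule χ.range) ?_ ?_ c ?_
  · intro h0
    refine hχ (DFunLike.ext _ _ fun g => ?_)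
    have : χ g ∈ AddSubgroup.toIntSubmodule χ.range := ⟨g, rfl⟩
    rw [h0] at this
    exact this
  · rw [Submodule.fg_iff_addSubgroup_fg]
    have : AddGroup.FG χ.range := AddGroup.fg_range χ
    exact (AddGroup.fg_iff_addSubgroup_fg _).1 this
  · rintro _ ⟨g, rfl⟩
    exact ⟨Additive.ofMul (φ g.toMul), h g.toMul⟩

/-- A positive factor by which an automorphism scales a nonzero transcendental character is `1`:
it is algebraic, hence rational, and it is a unit among the algebraic integers. -/
lemma scaling_eq_one [Group.FG G] {χ : RealCharacter G} (hχ : χ ≠ 0)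
    (ht : χ.IsTranscendental) (φ : G ≃* G) {c : ℝ} (hc : 0 < c)
    (h : ∀ g, χ (Additive.ofMul (φ g)) = c * χ (Additive.ofMul g)) : c = 1 := by
  have h1 : IsIntegral ℤ c := isIntegral_of_scaling hχ φ h
  have h2 : IsIntegral ℤ c⁻¹ := isIntegral_of_scaling hχ φ.symm fun g => by
    have := h (φ.symm g)
    rw [φ.apply_symm_apply] at this
    rw [this, inv_mul_cancel_left₀ hc.ne']
  obtain ⟨g, hg⟩ := RealCharacter.ne_zero_iff.1 hχ
  obtain ⟨q, hq⟩ : ∃ q : ℚ, (q : ℝ) = c := by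
    have e : χ (Additive.ofMul (φ g)) / χ (Additive.ofMul g) = c := by
      rw [h, mul_div_assoc, div_self hg, mul_one]
    rcases ht _ ⟨Additive.ofMul (φ g), rfl⟩ _ ⟨Additive.ofMul g, rfl⟩
      (by rw [h]; exact mul_ne_zero hc.ne' hg) hg with ⟨q, hq⟩ | htr
    · exact ⟨q, hq.trans e⟩
    · rw [e] at htr
      exact absurd (h1.tower_top (A := ℚ)).isAlgebraic htr
  have hint : ∀ q : ℚ, IsIntegral ℤ (q : ℝ) → ∃ n : ℤ, (n : ℝ) = q := by
    intro q hq
    have h3 : IsIntegral ℤ q := by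
      have h4 : IsIntegral ℤ (algebraMap ℚ ℝ q) := hq
      exact (isIntegral_algebraMap_iff (algebraMap ℚ ℝ).injective).1 h4
    obtain ⟨n, hn⟩ := IsIntegrallyClosed.isIntegral_iff.1 h3
    exact ⟨n, by rw [← hn]; simp⟩
  obtain ⟨a, ha⟩ := hint q (hq ▸ h1)
  obtain ⟨b, hb⟩ := hint q⁻¹ (by push_cast; rw [hq]; exact h2)
  push_cast at hb
  rw [hq] at ha hb
  have hab : a * b = 1 := by
    have : (a : ℝ) * b = 1 := by rw [ha, hb, mul_inv_cancel₀ hc.ne']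
    exact_mod_cast this
  rcases Int.eq_one_or_neg_one_of_mul_eq_one hab with h5 | h5
  · rw [← ha, h5, Int.cast_one]
  · rw [h5] at ha
    push_cast at ha
    linarith

/-- Every automorphism `φ` of a subgroup `K` of finite index of a group in `𝒮`, with
`b₁(K) = b₁(G)`, fixes a nonzero character. -/
theorem exists_invariant_character (hS : InClassS G) (K : Subgroup G) [K.FiniteIndex]
    (hb : firstBetti K = firstBetti G) (φ : K ≃* K) :
    ∃ χ : RealCharacter K, χ ≠ 0 ∧ ∀ k, χ (Additive.ofMul (φ k)) = χ (Additive.ofMul k) := by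
  have hfg := hS.fg
  have hfgK := Subgroup.fg_of_index_ne_zero K
  let r := RealCharacter.restrictEquiv K hb
  let L : RealCharacter G ≃ₗ[ℝ] RealCharacter G :=
    (r.trans (RealCharacter.comapEquiv φ)).trans r.symm
  have hrL : ∀ χ, r (L χ) = RealCharacter.comapEquiv φ (r χ) := fun χ => r.apply_symm_apply _
  have hL : ∀ χ, χ ≠ 0 → ((L χ).IsSigma ↔ χ.IsSigma) := by
    intro χ hχ
    rw [← RealCharacter.isSigma_restrict_iff K hχ,
      ← RealCharacter.isSigma_restrict_iff K (L.map_ne_zero_iff.2 hχ)]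
    have h1 : (L χ).restrict K = RealCharacter.comapEquiv φ (χ.restrict K) := hrL χ
    rw [h1, RealCharacter.isSigma_comapEquiv_iff]
  have hLpow : ∀ (n : ℕ) χ (k : K), (L ^ n) χ (Additive.ofMul (k : G)) =
      χ (Additive.ofMul ((φ ^ n) k : G)) := by
    intro n
    induction n with
    | zero => intro χ k; rfl
    | succ n ih =>
      intro χ k
      rw [pow_succ', LinearEquiv.mul_apply, pow_succ, MulAut.mul_apply, ← ih]
      exact DFunLike.congr_fun (hrL ((L ^ n) χ)) (Additive.ofMul k)
  obtain ⟨ξ, hξ, k, hk, hinv⟩ := exists_invariant_component L hL hS.nonempty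
  obtain ⟨m, v, hP, hv⟩ := hS.polytopes ξ hξ
  obtain ⟨j, n, c, hn, hc, hjn⟩ := hP.exists_eigen_vertex (L ^ k) hinv
    ⟨ξ, mem_connectedComponentIn hξ⟩
  have hv0 := hP.vertex_ne_zero j
  have hvC : v j ∈ sigmaComplCone G := by
    refine ⟨hv0, ?_⟩
    rw [← rayOfNeZero_mem_sigmaOne hv0]
    exact connectedComponentIn_subset _ _ (hP.vertex_mem j)
  rw [← pow_mul] at hjn
  set N := k * n with hN
  have hN0 : 0 < N := Nat.mul_pos hk hn
  have hc1 : c = 1 := by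
    refine scaling_eq_one (χ := (v j).restrict K) ?_ ?_ (φ ^ N) hc fun g => ?_
    · exact r.map_ne_zero_iff.2 hv0
    · rintro _ ⟨a, rfl⟩ _ ⟨b, rfl⟩
      exact hv j _ ⟨Additive.ofMul (a.toMul : G), rfl⟩ _ ⟨Additive.ofMul (b.toMul : G), rfl⟩
    · rw [RealCharacter.restrict_apply, ← hLpow, hjn]
      rfl
  rw [hc1, one_smul] at hjn
  -- The sum over the orbit of the vertex is fixed; it does not vanish since the orbit lies in an
  -- open hemisphere.
  let u := ∑ i ∈ Finset.range N, (L ^ i) (v j)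
  have hLu : L u = u := by
    have h1 : L u = ∑ i ∈ Finset.range N, (L ^ (i + 1)) (v j) := by
      rw [map_sum]
      exact Finset.sum_congr rfl fun i _ => by rw [pow_succ', LinearEquiv.mul_apply]
    rw [h1]
    have h2 := Finset.sum_range_succ' (fun i => (L ^ i) (v j)) N
    rw [Finset.sum_range_succ, hjn, pow_zero] at h2
    exact (add_right_cancel h2).symm
  have hu0 : u ≠ 0 := by
    obtain ⟨g, -, hg⟩ := hS.hemisphere
    have horb : ∀ i, (L ^ i) (v j) ∈ sigmaComplCone G := by
      intro i
      induction i with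
      | zero => exact hvC
      | succ i ih =>
        rw [pow_succ', LinearEquiv.mul_apply]
        exact ⟨L.map_ne_zero_iff.2 ih.1, fun h => ih.2 ((hL _ ih.1).1 h)⟩
    have hpos : ∀ i, 0 < (L ^ i) (v j) (Additive.ofMul g) := fun i => by
      rw [← mem_openHemisphere_iff (horb i).1]
      refine hg ?_
      rw [Set.mem_compl_iff, rayOfNeZero_mem_sigmaOne]
      exact (horb i).2
    intro h0
    have h1 : u (Additive.ofMul g) = ∑ i ∈ Finset.range N, (L ^ i) (v j) (Additive.ofMul g) :=
      AddMonoidHom.finsetSum_apply _ _ _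
    have h2 : 0 < u (Additive.ofMul g) :=
      h1 ▸ Finset.sum_pos (fun i _ => hpos i) ⟨0, Finset.mem_range.2 hN0⟩
    rw [h0] at h2
    exact lt_irrefl _ h2
  refine ⟨r u, r.map_ne_zero_iff.2 hu0, fun k => ?_⟩
  have := hrL u
  rw [hLu] at this
  exact (DFunLike.congr_fun this (Additive.ofMul k)).symm

end Invariant

/-! ### Twisted conjugacy and passage to commensurable groups -/

section Commensurable

variable {G : Type*} [Group G]

/-- An automorphism that preserves a subgroup `N` of finite index and a nonzero character of `N`
has infinitely many twisted conjugacy classes: `χ` separates the powers of some `x ∈ N` up to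
twisted conjugacy by `N`, and each twisted conjugacy class of `G` consists of finitely many
`N`-orbits. -/
lemma infinite_twistedConj_of_character (φ : G ≃* G) (N : Subgroup G) [N.FiniteIndex]
    (hN : ∀ x ∈ N, φ x ∈ N) {χ : RealCharacter N} (hχ : χ ≠ 0)
    (hφ : ∀ x : N, χ (Additive.ofMul ⟨φ x, hN x x.2⟩) = χ (Additive.ofMul x)) :
    Infinite (Quotient (twistedConj φ.toMonoidHom)) := by
  by_contra hfin
  rw [not_infinite_iff_finite] at hfin
  obtain ⟨x, hx⟩ := RealCharacter.ne_zero_iff.1 hχ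
  have hrep : ∀ n : ℕ, ∃ σ : G, ((x : G) ^ n) =
      σ * (Quotient.mk (twistedConj φ.toMonoidHom) ((x : G) ^ n)).out * (φ σ)⁻¹ := fun n =>
    Quotient.mk_out (s := twistedConj φ.toMonoidHom) ((x : G) ^ n)
  choose σ hσ using hrep
  have : Finite (G ⧸ N) := inferInstance
  obtain ⟨m, n, hmn, e⟩ := Finite.exists_ne_map_eq_of_infinite fun n : ℕ =>
    ((Quotient.mk (twistedConj φ.toMonoidHom) ((x : G) ^ n)), (((σ n)⁻¹ : G) : G ⧸ N))
  rw [Prod.mk.injEq] at e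
  obtain ⟨e1, e2⟩ := e
  rw [QuotientGroup.eq, inv_inv] at e2
  let ν : N := ⟨_, e2⟩
  have h1 : x ^ m = ν * x ^ n * (⟨φ ν, hN ν ν.2⟩ : N)⁻¹ := by
    apply Subtype.ext
    push_cast
    rw [hσ m, hσ n, e1]
    simp [ν, mul_assoc]
  have h2 := congrArg (fun y => χ (Additive.ofMul y)) h1
  simp only [RealCharacter.map_mul, RealCharacter.map_inv, RealCharacter.map_pow, hφ] at h2
  have h3 : (m : ℝ) * χ (Additive.ofMul x) = n * χ (Additive.ofMul x) := by linarith
  exact hmn (by exact_mod_cast mul_right_cancel₀ hx h3)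

lemma group_fg_of_finiteIndex (K : Subgroup G) [K.FiniteIndex] [hK : Group.FG K] :
    Group.FG G := by
  classical
  obtain ⟨S, hS⟩ := Group.fg_def.1 hK
  have : Finite (G ⧸ K) := inferInstance
  have hfin : (Set.range fun q : G ⧸ K => q.out).Finite := Set.finite_range _
  refine Group.fg_iff.2 ⟨(↑) '' (S : Set K) ∪ Set.range fun q : G ⧸ K => q.out, ?_,
    (S.finite_toSet.image _).union hfin⟩
  rw [eq_top_iff]
  intro g _
  have h1 : (g : G ⧸ K).out⁻¹ * g ∈ K := by
    rw [← QuotientGroup.eq, QuotientGroup.out_eq']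
  have h2 : K ≤ Subgroup.closure ((↑) '' (S : Set K)) := by
    have := congrArg (Subgroup.map K.subtype) hS
    rw [MonoidHom.map_closure, ← MonoidHom.range_eq_map, Subgroup.range_subtype] at this
    exact this.ge
  have h3 := mul_mem
    (Subgroup.subset_closure (Or.inr ⟨(g : G ⧸ K), rfl⟩) : (g : G ⧸ K).out ∈
      Subgroup.closure ((↑) '' (S : Set K) ∪ Set.range fun q : G ⧸ K => q.out))
    (Subgroup.closure_mono Set.subset_union_left (h2 h1))
  rwa [mul_inv_cancel_left] at h3

/-- A subgroup of finite index of a finitely generated group contains a subgroup of finite index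
that is preserved by all automorphisms. -/
lemma exists_characteristic_finiteIndex_le [hG : Group.FG G] (K : Subgroup G) [K.FiniteIndex] :
    ∃ N ≤ K, N.FiniteIndex ∧ ∀ (φ : G ≃* G), ∀ x ∈ N, φ x ∈ N := by
  have : Finite (G ⧸ K) := inferInstance
  obtain ⟨S, hS⟩ := Group.fg_def.1 hG
  have : Finite (G →* Equiv.Perm (G ⧸ K)) := by
    refine Finite.of_injective (β := S → Equiv.Perm (G ⧸ K)) (fun f s => f s) fun f f' h => ?_
    refine MonoidHom.eq_of_eqOn_dense hS fun s hs => ?_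
    exact congrFun h ⟨s, hs⟩
  refine ⟨⨅ f : G →* Equiv.Perm (G ⧸ K), f.ker, ?_, ?_, ?_⟩
  · refine (iInf_le _ (MulAction.toPermHom G (G ⧸ K))).trans ?_
    rw [← Subgroup.normalCore_eq_ker]
    exact K.normalCore_le
  · exact Subgroup.finiteIndex_iInf fun f => Subgroup.finiteIndex_ker f
  · intro φ x hx
    rw [Subgroup.mem_iInf] at hx ⊢
    exact fun f => hx (f.comp φ.toMonoidHom)

end Commensurable

theorem theorem1p1 {G : Type*} [Group G] (hfg : Group.FG G)
    (hb : ∀ H : Subgroup G, H.FiniteIndex → firstBetti H = firstBetti G)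
    (hS : InClassS G) {G' : Type*} [Group G'] (hcomm : GroupsCommensurable G G') :
    HasPropertyRInfty G' := by
  intro φ
  obtain ⟨H, K, hH, hK, ⟨e⟩⟩ := hcomm
  have hfgH := Subgroup.fg_of_index_ne_zero H
  have hfgK : Group.FG K := Group.fg_of_surjective (f := e.toMonoidHom) e.surjective
  have hfgG' := group_fg_of_finiteIndex K
  obtain ⟨N, hNK, hNfin, hN⟩ := exists_characteristic_finiteIndex_le K
  let φN : N ≃* N :=
    { toFun := fun x => ⟨φ x, hN φ x x.2⟩
      invFun := fun x => ⟨φ.symm x, hN φ.symm x x.2⟩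
      left_inv := fun x => Subtype.ext (φ.symm_apply_apply x)
      right_inv := fun x => Subtype.ext (φ.apply_symm_apply x)
      map_mul' := fun x y => Subtype.ext (map_mul φ (x : G') y) }
  -- `N` is isomorphic to a subgroup of finite index of `G`.
  let j : N →* G := H.subtype.comp (e.symm.toMonoidHom.comp (Subgroup.inclusion hNK))
  have hj : Function.Injective j :=
    H.subtype_injective.comp (e.symm.injective.comp (Subgroup.inclusion_injective hNK))
  have hrange : j.range = ((N.subgroupOf K).map e.symm.toMonoidHom).map H.subtype := by
    rw [MonoidHom.range_comp, MonoidHom.range_comp, Subgroup.inclusion_range]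
  have hjfin : j.range.FiniteIndex := by
    refine ⟨?_⟩
    rw [hrange, Subgroup.index_map_subtype]
    have h1 : ((N.subgroupOf K).map e.symm.toMonoidHom).index = (N.subgroupOf K).index :=
      Subgroup.index_map_equiv _ e.symm
    rw [h1]
    exact mul_ne_zero Subgroup.FiniteIndex.index_ne_zero Subgroup.FiniteIndex.index_ne_zero
  let α : N ≃* j.range := MonoidHom.ofInjective hj
  obtain ⟨χ, hχ, hinv⟩ := exists_invariant_character hS j.range (hb _ hjfin)
    ((α.symm.trans φN).trans α)
  refine infinite_twistedConj_of_character φ N (hN φ)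
    (χ := RealCharacter.comapEquiv α χ) ((RealCharacter.comapEquiv α).map_ne_zero_iff.2 hχ) ?_
  intro x
  have := hinv (α x)
  rw [MulEquiv.trans_apply, MulEquiv.trans_apply, MulEquiv.symm_apply_apply] at this
  exact this
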